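/- Let $k$ be a field of characteristic $0$ and $n\in\mathbb Z$. A formal moduli problem is represented by a finite-dimensional $\mathbb Z$-graded vector space $\mathfrak g$ with an $L_\infty$ structure, i.e. a vector field $Q_{\mathfrak g}$ of degree $1$ on $\mathfrak g[1]$ (a derivation of $\mathcal O(X)=\widehat{\mathrm{Sym}}(\mathfrak g^*[-1])$) which vanishes at the origin and satisfies $Q_{\mathfrak g}^2=0$. Let $X$ be a formal moduli problem with $L_\infty$ algebra $\mathfrak g$, with a strict constant coefficient $n$-shifted symplectic structure, i.e. a graded symmetric linear isomorphism $\omega:\mathfrak g\to\mathfrak g^*[n-2]$, and suppose that the $L_\infty$ structure is given by an action functional: $Q_{\mathfrak g}$ is the Hamiltonian vector field of some $S\in\mathcal O(X)$ of cohomological degree $n+1$ without terms of polynomial degree $0$ and $1$. Let $L_+\hookrightarrow X$ be a regular embedded Lagrangian, i.e. a formal moduli problem with finite-dimensional $L_\infty$ algebra $(\mathfrak l_+,Q_{\mathfrak l_+})$ and an injective strict $L_\infty$ map $\mathfrak l_+\to\mathfrak g$ such that $\omega$ vanishes on $\mathfrak l_+$, and fix a graded complement $\mathfrak l_-$ of $\mathfrak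 l_+$ in $\mathfrak g$ on which $\omega$ vanishes as well. Then $\omega$ identifies $\mathfrak l_-$ with $\mathfrak l_+^*[n-2]$, and $\mathfrak g\cong\mathfrak l_+\oplus\mathfrak l_+^*[n-2]$ induces $$\Phi:\mathcal O(X)\;\cong\;\widehat{\mathrm{Sym}}(\mathfrak l_+^*[-1])\,\widehat\otimes\,\widehat{\mathrm{Sym}}(\mathfrak l_+[1-n])=\prod_{j\ge 0}\Gamma\bigl(L_+,\mathrm{Sym}^j(\mathbb T_{L_+}[-n])\bigr).$$ Write $\Phi(S)=\sum_{j\ge0}S_j$ with $S_j\in\Gamma(L_+,\mathrm{Sym}^j(\mathbb T_{L_+}[-n]))$, of cohomological degree $n+1$. Then: 1. $S_0=0$; 2. $S_1=Q_{\mathfrak l_+}$, the cohomological vector field defining the $L_\infty$ structure on $\mathfrak l_+$; thus $\Phi(S)=Q_{\mathfrak l_+}+\bar\Pi$ with $\bar\Pi=\sum_{j\ge2}S_j$; 3. $\bar\Pi=\{S_j\}_{j\ge2}$ is an $(n-1)$-shifted homotopy Poisson structure on $L_+$, i.e. $[Q_{\mathfrak l_+}+\bar\Pi,\,Q_{\mathfrak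 l_+}+\bar\Pi]=0$ for the Schouten bracket; 4. for every $T\in\mathcal O(X)$ of cohomological degree $n+1$, the classical master equation $\{T,T\}_\omega=0$ is equivalent to $[\Phi(T),\Phi(T)]=0$; in particular the classical master equation for $S$ is equivalent to the equation in 3. -/

import Mathlib

open scoped Polynomial

universe u v w x

noncomputable section

/-! ### Finite-dimensional `ℤ`-graded vector spaces -/

/-- A finite-dimensional `ℤ`-graded vector space over `k`. -/
structure GrSpace (k : Type u) [Field k] where
  carrier : Type v
  [addCommGroup : AddCommGroup carrier]
  [module : Module k carrier]
  [finiteDimensional : FiniteDimensional k carrier]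
  /-- the homogeneous components -/
  gr : ℤ → Submodule k carrier
  internal : DirectSum.IsInternal gr

namespace GrSpace

instance {k : Type u} [Field k] : CoeSort (GrSpace.{u, v} k) (Type v) := ⟨GrSpace.carrier⟩

attribute [instance] GrSpace.addCommGroup GrSpace.module GrSpace.finiteDimensional

/-- The sign `(-1) ^ m` as an element of `k`. -/
def ksign (k : Type u) [Field k] (m : ℤ) : k := ((m.negOnePow : ℤ) : k)

lemma ksign_of_even {k : Type u} [Field k] {m : ℤ} (h : Even m) : ksign k m = 1 := by
  simp [ksign, Int.negOnePow_even m h]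

lemma ksign_of_odd {k : Type u} [Field k] {m : ℤ} (h : Odd m) : ksign k m = -1 := by
  simp [ksign, Int.negOnePow_odd m h]

variable {k : Type u} [Field k]

/-- The linear endomorphism acting on the component of degree `d` as the scalar `c d`. -/
def diag (A : GrSpace.{u, v} k) (c : ℤ → k) : A →ₗ[k] A :=
  (DirectSum.toModule k ℤ A fun d => c d • (A.gr d).subtype) ∘ₗ
    (LinearEquiv.ofBijective (DirectSum.coeLinearMap A.gr) A.internal).symm.toLinearMap

lemma diag_of_mem (A : GrSpace.{u, v} k) (c : ℤ → k) {d : ℤ} {a : A} (ha : a ∈ A.gr d) :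
    A.diag c a = c d • a := by
  have : (LinearEquiv.ofBijective (DirectSum.coeLinearMap A.gr) A.internal).symm a
      = DirectSum.lof k ℤ (fun d => A.gr d) d ⟨a, ha⟩ := by
    rw [LinearEquiv.symm_apply_eq]
    exact (DirectSum.coeLinearMap_lof (A := A.gr) d ⟨a, ha⟩).symm
  rw [diag, LinearMap.comp_apply, LinearEquiv.coe_coe, this, DirectSum.toModule_lof]
  rfl

lemma induction_gr (A : GrSpace.{u, v} k) {p : A → Prop} (a : A)
    (hm : ∀ d, ∀ b ∈ A.gr d, p b) (h0 : p 0) (ha : ∀ b c, p b → p c → p (b + c)) : p a := by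
  have : a ∈ ⨆ d, A.gr d := by
    rw [A.internal.submodule_iSup_eq_top]; trivial
  exact Submodule.iSup_induction A.gr (motive := p) this hm h0 ha

/-- The component of degree `d`. -/
def proj (A : GrSpace.{u, v} k) (d : ℤ) : A →ₗ[k] A := A.diag fun e => if e = d then 1 else 0

lemma proj_of_mem (A : GrSpace.{u, v} k) {d : ℤ} {a : A} (ha : a ∈ A.gr d) (e : ℤ) :
    A.proj e a = if d = e then a else 0 := by
  rw [proj, diag_of_mem A _ ha]; split_ifs <;> simp

lemma proj_mem (A : GrSpace.{u, v} k) (d : ℤ) (a : A) : A.proj d a ∈ A.gr d := by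
  refine A.induction_gr (p := fun a => A.proj d a ∈ A.gr d) a ?_ (by simp) ?_
  · intro e b hb
    rw [A.proj_of_mem hb]
    split_ifs with h
    · exact h ▸ hb
    · exact zero_mem _
  · intro b c hb hc
    rw [map_add]; exact add_mem hb hc

lemma exists_sum_proj (A : GrSpace.{u, v} k) (a : A) :
    ∃ s : Finset ℤ, ∀ t : Finset ℤ, s ⊆ t → a = ∑ d ∈ t, A.proj d a := by
  refine A.induction_gr (p := fun a => ∃ s : Finset ℤ, ∀ t : Finset ℤ, s ⊆ t →
    a = ∑ d ∈ t, A.proj d a) a ?_ ⟨∅, by simp⟩ ?_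
  · intro e b hb
    refine ⟨{e}, fun t ht => ?_⟩
    simp only [A.proj_of_mem hb]
    rw [Finset.sum_ite_eq, if_pos (ht (by simp))]
  · rintro b c ⟨s, hs⟩ ⟨s', hs'⟩
    refine ⟨s ∪ s', fun t ht => ?_⟩
    simp only [map_add, Finset.sum_add_distrib]
    rw [← hs t (Finset.union_subset_left ht), ← hs' t (Finset.union_subset_right ht)]

lemma eq_of_proj_eq (A : GrSpace.{u, v} k) {a b : A} (h : ∀ d, A.proj d a = A.proj d b) :
    a = b := by
  obtain ⟨s, hs⟩ := A.exists_sum_proj a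
  obtain ⟨t, ht⟩ := A.exists_sum_proj b
  rw [hs (s ∪ t) Finset.subset_union_left, ht (s ∪ t) Finset.subset_union_right]
  simp only [h]

lemma mem_gr_of_proj (A : GrSpace.{u, v} k) {d : ℤ} {a : A} (h : ∀ e, e ≠ d → A.proj e a = 0) :
    a ∈ A.gr d := by
  have : a = A.proj d a := by
    refine A.eq_of_proj_eq fun e => ?_
    rw [A.proj_of_mem (A.proj_mem d a)]
    split_ifs with he
    · rw [he]
    · exact h e (Ne.symm he)
  rw [this]; exact A.proj_mem d a

/-- Criterion for a family of subspaces to be a grading, through a family of projections. -/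
lemma isInternal_of_proj {W : Type w} [AddCommGroup W] [Module k W] (g : ℤ → Submodule k W)
    (π : ℤ → W →ₗ[k] W) (hπ : ∀ d e, ∀ a ∈ g d, π e a = if d = e then a else 0)
    (htop : ∀ a, a ∈ ⨆ d, g d) : DirectSum.IsInternal g := by
  refine DirectSum.isInternal_submodule_of_iSupIndep_of_iSup_eq_top ?_
    (eq_top_iff.2 fun a _ => htop a)
  rw [iSupIndep_def]
  intro d
  rw [Submodule.disjoint_def]
  intro a ha ha'
  have h1 : π d a = a := by rw [hπ d d a ha, if_pos rfl]
  have h2 : (⨆ (j) (_ : j ≠ d), g j) ≤ LinearMap.ker (π d) := by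
    refine iSup₂_le fun j hj b hb => ?_
    rw [LinearMap.mem_ker, hπ j d b hb, if_neg hj]
  rw [← h1]; exact h2 ha'

/-- The shift `A[m]`, with `(A[m])^d = A^(d+m)`. -/
@[reducible] def shift (A : GrSpace.{u, v} k) (m : ℤ) : GrSpace.{u, v} k where
  carrier := A
  gr d := A.gr (d + m)
  internal := by
    refine isInternal_of_proj _ (fun d => A.proj (d + m)) (fun d e a ha => ?_) (fun a => ?_)
    · rw [A.proj_of_mem ha]; simp
    · refine A.induction_gr (p := fun a => a ∈ ⨆ d, A.gr (d + m)) a ?_ (zero_mem _)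
        (fun _ _ => add_mem)
      intro d b hb
      refine Submodule.mem_iSup_of_mem (d - m) ?_
      simpa using hb

/-- The linear dual, in which a functional of degree `d` lives on the component of degree `-d`. -/
@[reducible] def dual (A : GrSpace.{u, v} k) : GrSpace.{u, max u v} k where
  carrier := Module.Dual k A
  gr d :=
    { carrier := {φ | ∀ e, e ≠ -d → ∀ a ∈ A.gr e, φ a = 0}
      add_mem' := fun {φ ψ} hφ hψ e he a ha => by simp [hφ e he a ha, hψ e he a ha]
      zero_mem' := fun e he a ha => rfl
      smul_mem' := fun c φ hφ e he a ha => by simp [hφ e he a ha] }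
  internal := by
    refine isInternal_of_proj _ (fun d => (A.proj (-d)).dualMap) (fun d e φ hφ => ?_) (fun φ => ?_)
    · refine LinearMap.ext fun a => ?_
      refine A.induction_gr (p := fun a => ((A.proj (-e)).dualMap φ) a
        = (if d = e then φ else 0 : Module.Dual k A) a) a ?_ (by simp) ?_
      · intro c b hb
        rw [LinearMap.dualMap_apply, A.proj_of_mem hb]
        by_cases hc : c = -d
        · subst hc
          by_cases hde : d = e <;> simp [hde]
        · have := hφ c hc b hb
          by_cases hde : d = e <;> by_cases h2 : c = -e <;> simp [hde, h2, this]
      · intro b c hb hc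
        simp only [map_add, hb, hc]
    · let b := Module.finBasis k A
      choose s hs using fun i => A.exists_sum_proj (b i)
      let t : Finset ℤ := Finset.univ.biUnion s
      have key : φ = ∑ d ∈ t, (A.proj d).dualMap φ := by
        refine b.ext fun i => ?_
        conv_lhs => rw [hs i t (Finset.subset_biUnion_of_mem s (Finset.mem_univ i))]
        simp [LinearMap.sum_apply]
      rw [key]
      refine sum_mem fun d _ => Submodule.mem_iSup_of_mem (-d) ?_
      intro e he a ha
      rw [LinearMap.dualMap_apply, A.proj_of_mem ha, if_neg (by simpa using he), map_zero]

/-- The direct sum of two graded vector spaces. -/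
@[reducible] def prod (A : GrSpace.{u, v} k) (B : GrSpace.{u, w} k) : GrSpace.{u, max v w} k where
  carrier := A × B
  gr d := (A.gr d).prod (B.gr d)
  internal := by
    refine isInternal_of_proj _ (fun d => (A.proj d).prodMap (B.proj d)) (fun d e a ha => ?_)
      (fun a => ?_)
    · rw [LinearMap.prodMap_apply, A.proj_of_mem ha.1, B.proj_of_mem ha.2]
      split_ifs <;> rfl
    · have h1 : ∀ y : A, (y, (0 : B)) ∈ ⨆ d, (A.gr d).prod (B.gr d) := fun y =>
        A.induction_gr (p := fun y => (y, (0 : B)) ∈ ⨆ d, (A.gr d).prod (B.gr d)) y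
          (fun d b hb => Submodule.mem_iSup_of_mem d ⟨hb, zero_mem _⟩) (zero_mem _)
          (fun b c hb hc => by simpa using add_mem hb hc)
      have h2 : ∀ y : B, ((0 : A), y) ∈ ⨆ d, (A.gr d).prod (B.gr d) := fun y =>
        B.induction_gr (p := fun y => ((0 : A), y) ∈ ⨆ d, (A.gr d).prod (B.gr d)) y
          (fun d b hb => Submodule.mem_iSup_of_mem d ⟨zero_mem _, hb⟩) (zero_mem _)
          (fun b c hb hc => by simpa using add_mem hb hc)
      simpa using add_mem (h1 a.1) (h2 a.2)

/-- `v ↦ (-1) ^ (m |v|) v`. -/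
def sgn (A : GrSpace.{u, v} k) (m : ℤ) : A →ₗ[k] A := A.diag fun d => ksign k (m * d)

/-- The projection to the components whose degree has the parity of `ε`. -/
def parity (A : GrSpace.{u, v} k) (ε : ℤ) : A →ₗ[k] A :=
  open Classical in A.diag fun d => if Even (d + ε) then 1 else 0

end GrSpace

open GrSpace

/-- A degree-preserving linear map. -/
structure GrHom {k : Type u} [Field k] (A : GrSpace.{u, v} k) (B : GrSpace.{u, w} k) where
  lin : A →ₗ[k] B
  map_gr : ∀ d, ∀ a ∈ A.gr d, lin a ∈ B.gr d

namespace GrHom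

variable {k : Type u} [Field k]

lemma proj_comm {A : GrSpace.{u, v} k} {B : GrSpace.{u, w} k} (f : GrHom A B) (d : ℤ) (a : A) :
    B.proj d (f.lin a) = f.lin (A.proj d a) := by
  refine A.induction_gr (p := fun a => B.proj d (f.lin a) = f.lin (A.proj d a)) a ?_ (by simp) ?_
  · intro e b hb
    rw [B.proj_of_mem (f.map_gr e b hb), A.proj_of_mem hb]
    split_ifs <;> simp
  · intro b c hb hc
    simp only [map_add, hb, hc]

/-- The inverse of a bijective degree-preserving map. -/
def inverse {A : GrSpace.{u, v} k} {B : GrSpace.{u, w} k} (f : GrHom A B)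
    (hf : Function.Bijective f.lin) : GrHom B A where
  lin := (LinearEquiv.ofBijective f.lin hf).symm.toLinearMap
  map_gr d b hb := by
    obtain ⟨a, rfl⟩ := hf.2 b
    have : (LinearEquiv.ofBijective f.lin hf).symm (f.lin a) = a := by
      rw [LinearEquiv.symm_apply_eq]; rfl
    rw [LinearEquiv.coe_coe, this]
    refine A.mem_gr_of_proj fun e he => hf.1 ?_
    rw [← f.proj_comm, B.proj_of_mem hb, if_neg (Ne.symm he), map_zero]

/-- A degree-preserving map `A → B` seen as a map `A[m] → B[m]`. -/
@[reducible] def shift {A : GrSpace.{u, v} k} {B : GrSpace.{u, w} k} (f : GrHom A B) (m : ℤ) :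
    GrHom (A.shift m) (B.shift m) where
  lin := f.lin
  map_gr d a ha := f.map_gr (d + m) a ha

/-- The transpose. -/
@[reducible] def dual {A : GrSpace.{u, v} k} {B : GrSpace.{u, w} k} (f : GrHom A B) :
    GrHom B.dual A.dual where
  lin := f.lin.dualMap
  map_gr _ _ hφ e he a ha := hφ e he _ (f.map_gr e a ha)

@[reducible] def inl (A : GrSpace.{u, v} k) (B : GrSpace.{u, w} k) : GrHom A (A.prod B) where
  lin := LinearMap.inl k A B
  map_gr _ _ ha := ⟨ha, zero_mem _⟩

@[reducible] def inr (A : GrSpace.{u, v} k) (B : GrSpace.{u, w} k) : GrHom B (A.prod B) where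
  lin := LinearMap.inr k A B
  map_gr _ _ ha := ⟨zero_mem _, ha⟩

/-- `(a, b) ↦ f a + g b`. -/
@[reducible] def coprod {A : GrSpace.{u, v} k} {B : GrSpace.{u, w} k} {C : GrSpace.{u, x} k}
    (f : GrHom A C) (g : GrHom B C) : GrHom (A.prod B) C where
  lin := f.lin.coprod g.lin
  map_gr d _ ha := add_mem (f.map_gr d _ ha.1) (g.map_gr d _ ha.2)

end GrHom

/-! ### The graded symmetric algebra and its completion -/

/-- The relations `a b = (-1) ^ (|a| |b|) b a`. -/
inductive GSym.Rel {k : Type u} [Field k] (A : GrSpace.{u, v} k) :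
    TensorAlgebra k A → TensorAlgebra k A → Prop
  | comm {d e : ℤ} {a b : A} (ha : a ∈ A.gr d) (hb : b ∈ A.gr e) :
      GSym.Rel A (TensorAlgebra.ι k a * TensorAlgebra.ι k b)
        (ksign k (d * e) • (TensorAlgebra.ι k b * TensorAlgebra.ι k a))

/-- The graded symmetric algebra `Sym(A)` (in characteristic different from `2`). -/
abbrev GSym {k : Type u} [Field k] (A : GrSpace.{u, v} k) : Type (max u v) :=
  RingQuot (GSym.Rel A)

namespace GSym

variable {k : Type u} [Field k]

/-- The inclusion of the generators. -/
def ι (A : GrSpace.{u, v} k) : A →ₗ[k] GSym A :=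
  (RingQuot.mkAlgHom k (Rel A)).toLinearMap ∘ₗ TensorAlgebra.ι k

lemma ι_comm (A : GrSpace.{u, v} k) {d e : ℤ} {a b : A} (ha : a ∈ A.gr d) (hb : b ∈ A.gr e) :
    ι A a * ι A b = ksign k (d * e) • (ι A b * ι A a) := by
  have := RingQuot.mkAlgHom_rel k (Rel.comm (A := A) ha hb)
  simpa [ι] using this

/-- The universal property of `Sym(A)`. -/
def lift {A : GrSpace.{u, v} k} {R : Type w} [Ring R] [Algebra k R] (f : A →ₗ[k] R)
    (hf : ∀ d e, ∀ a ∈ A.gr d, ∀ b ∈ A.gr e, f a * f b = ksign k (d * e) • (f b * f a)) :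
    GSym A →ₐ[k] R :=
  RingQuot.liftAlgHom k ⟨TensorAlgebra.lift k f, by
    rintro _ _ ⟨ha, hb⟩
    simpa using hf _ _ _ ha _ hb⟩

lemma lift_ι {A : GrSpace.{u, v} k} {R : Type w} [Ring R] [Algebra k R] (f : A →ₗ[k] R)
    (hf : ∀ d e, ∀ a ∈ A.gr d, ∀ b ∈ A.gr e, f a * f b = ksign k (d * e) • (f b * f a)) (a : A) :
    lift f hf (ι A a) = f a := by
  simp [lift, ι, RingQuot.liftAlgHom_mkAlgHom_apply]

/-- The `p`-th symmetric power `Sym^p(A)`, inside `Sym(A)`. -/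
def pow (A : GrSpace.{u, v} k) (p : ℕ) : Submodule k (GSym A) := LinearMap.range (ι A) ^ p

/-- The elements of cohomological degree `d` of `Sym(A)`. -/
def homog (A : GrSpace.{u, v} k) (d : ℤ) : Submodule k (GSym A) :=
  Submodule.span k {a | ∃ l : List (ℤ × A), (∀ y ∈ l, y.2 ∈ A.gr y.1) ∧
    (l.map Prod.fst).sum = d ∧ (l.map fun y => ι A y.2).prod = a}

/-- Functoriality of `Sym`. -/
def map {A : GrSpace.{u, v} k} {B : GrSpace.{u, w} k} (f : GrHom A B) : GSym A →ₐ[k] GSym B :=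
  lift (ι B ∘ₗ f.lin) fun d e a ha b hb => ι_comm B (f.map_gr d a ha) (f.map_gr e b hb)

lemma map_mem_pow {A : GrSpace.{u, v} k} {B : GrSpace.{u, w} k} (f : GrHom A B) (p : ℕ)
    {a : GSym A} (ha : a ∈ pow A p) : map f a ∈ pow B p := by
  have h : (pow A p).map (map f).toLinearMap ≤ pow B p := by
    rw [pow, pow, Submodule.map_pow]
    refine pow_le_pow_left' ?_ p
    rintro _ ⟨_, ⟨y, rfl⟩, rfl⟩
    exact ⟨f.lin y, by simp [map, lift_ι]⟩
  exact h ⟨a, ha, rfl⟩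

/-- The algebra map `a ↦ [[σ^i a, D a], [0, σ^j a]]`, where `σ` is the parity involution and `D`
is the twisted derivation, `D (a b) = D(a) σ^j(b) + σ^i(a) D(b)`, whose values on the generators
are given by the part of `φ` of the parity of `i + j`. -/
def contractHom (A : GrSpace.{u, v} k) (i j : ℤ) (φ : Module.Dual k A) :
    GSym A →ₐ[k] Matrix (Fin 2) (Fin 2) (GSym A) :=
  lift
    { toFun := fun a => !![ι A (A.sgn i a), algebraMap k _ (φ (A.parity (i + j) a));
        0, ι A (A.sgn j a)]
      map_add' := fun a b => by ext p q; fin_cases p <;> fin_cases q <;> simp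
      map_smul' := fun c a => by
        ext p q; fin_cases p <;> fin_cases q <;> simp [Algebra.smul_def] } (by
    intro d e a ha b hb
    have hc := ι_comm A ha hb
    have aux : ∀ i j d e : ℤ, Even (e + (i + j)) →
        ksign k (i * d) = ksign k (d * e) * ksign k (j * d) := by
      intro i j d e he
      simp only [ksign, ← Int.cast_mul, ← Units.val_mul, ← Int.negOnePow_add]
      congr 2
      rw [Int.negOnePow_eq_iff]
      have : i * d - (d * e + j * d) = d * ((e + (i + j)) - 2 * (e + j)) := by ring
      rw [this]
      exact (he.sub (even_two_mul _)).mul_left d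
    have key : ksign k (i * d) * φ (A.parity (i + j) b)
        = ksign k (d * e) * (ksign k (j * d) * φ (A.parity (i + j) b)) := by
      rw [GrSpace.parity, diag_of_mem A _ hb]
      by_cases he : Even (e + (i + j))
      · rw [aux i j d e he, mul_assoc]
      · simp [he]
    have key' : ksign k (j * e) * φ (A.parity (i + j) a)
        = ksign k (d * e) * (ksign k (i * e) * φ (A.parity (i + j) a)) := by
      rw [GrSpace.parity, diag_of_mem A _ ha]
      by_cases he : Even (d + (i + j))
      · rw [aux j i e d (by rwa [add_comm j i]), mul_comm e d, mul_assoc]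
      · simp [he]
    have hs : ∀ m : ℤ, A.sgn m a = ksign k (m * d) • a := fun m => diag_of_mem A _ ha
    have hs' : ∀ m : ℤ, A.sgn m b = ksign k (m * e) • b := fun m => diag_of_mem A _ hb
    ext p q
    fin_cases p <;> fin_cases q
    · simp [hs, hs', hc, smul_smul]
      ring_nf
    · simp only [LinearMap.coe_mk, AddHom.coe_mk, hs, hs', map_smul, Fin.zero_eta, Fin.mk_one,
        Matrix.mul_apply, Matrix.smul_apply, Fin.sum_univ_two, Matrix.of_apply, Matrix.cons_val',
        Matrix.cons_val_zero, Matrix.cons_val_one, Matrix.cons_val_fin_one]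
      rw [← Algebra.commutes, ← Algebra.commutes, ← Algebra.smul_def, ← Algebra.smul_def,
        ← Algebra.smul_def, ← Algebra.smul_def]
      simp only [smul_smul, smul_add]
      rw [mul_comm _ (ksign k (i * d)), key, mul_comm _ (ksign k (j * e)), key',
        mul_comm _ (ksign k (i * e)), mul_comm _ (ksign k (j * d)), add_comm]
    · simp
    · simp [hs, hs', hc, smul_smul]
      ring_nf)

lemma contractHom_ι (A : GrSpace.{u, v} k) (i j : ℤ) (φ : Module.Dual k A) (a : A) :
    contractHom A i j φ (ι A a) =
      !![ι A (A.sgn i a), algebraMap k _ (φ (A.parity (i + j) a)); 0, ι A (A.sgn j a)] :=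
  lift_ι _ _ a

/-- The twisted derivation in the upper right corner of `contractHom`. -/
def contract (A : GrSpace.{u, v} k) (i j : ℤ) (φ : Module.Dual k A) : GSym A →ₗ[k] GSym A where
  toFun a := contractHom A i j φ a 0 1
  map_add' a b := by simp
  map_smul' c a := by simp

lemma contractHom_lower (A : GrSpace.{u, v} k) (i j : ℤ) (φ : Module.Dual k A) (p : ℕ)
    (a : GSym A) (ha : a ∈ pow A p) :
    contractHom A i j φ a 0 0 ∈ pow A p ∧ contractHom A i j φ a 1 1 ∈ pow A p ∧
      contractHom A i j φ a 1 0 = 0 ∧ (p = 0 → contractHom A i j φ a 0 1 = 0) ∧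
      ∀ q, p = q + 1 → contractHom A i j φ a 0 1 ∈ pow A q := by
  unfold pow at ha
  induction ha using Submodule.pow_induction_on_left' with
  | algebraMap r =>
    have h1 : algebraMap k (GSym A) r ∈ pow A 0 := by
      rw [pow, pow_zero]; exact Submodule.algebraMap_mem r
    have h2 : contractHom A i j φ (algebraMap k (GSym A) r)
        = algebraMap k (Matrix (Fin 2) (Fin 2) (GSym A)) r := AlgHom.commutes _ _
    simp only [h2, Matrix.algebraMap_matrix_apply]
    exact ⟨h1, h1, rfl, fun _ => rfl, fun q hq => absurd hq (by omega)⟩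
  | add b c p hb hc ihb ihc =>
    simp only [map_add, Matrix.add_apply]
    exact ⟨add_mem ihb.1 ihc.1, add_mem ihb.2.1 ihc.2.1, by rw [ihb.2.2.1, ihc.2.2.1, add_zero],
      fun h => by rw [ihb.2.2.2.1 h, ihc.2.2.2.1 h, add_zero],
      fun q hq => add_mem (ihb.2.2.2.2 q hq) (ihc.2.2.2.2 q hq)⟩
  | mem_mul m hm p b hb ih =>
    obtain ⟨y, rfl⟩ := hm
    have hι : ∀ z : A, ι A z ∈ LinearMap.range (ι A) := fun z => ⟨z, rfl⟩
    have hmul : ∀ (z : A) (q : ℕ) (c : GSym A), c ∈ pow A q → ι A z * c ∈ pow A (q + 1) := by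
      intro z q c hc
      rw [pow, pow_succ']
      exact Submodule.mul_mem_mul (hι z) hc
    simp only [map_mul, Matrix.mul_apply, Fin.sum_univ_two, contractHom_ι, Matrix.of_apply,
      Matrix.cons_val', Matrix.cons_val_zero, Matrix.cons_val_one, Matrix.cons_val_fin_one,
      ih.2.2.1, mul_zero, zero_mul, add_zero, zero_add]
    refine ⟨hmul _ _ _ ih.1, hmul _ _ _ ih.2.1, trivial, fun h => absurd h (by omega), ?_⟩
    intro q hq
    obtain rfl : p = q := by omega
    refine add_mem ?_ ?_
    · rcases p with _ | p
      · rw [ih.2.2.2.1 rfl, mul_zero]; exact zero_mem _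
      · exact hmul _ _ _ (ih.2.2.2.2 p rfl)
    · rw [← Algebra.smul_def]
      exact Submodule.smul_mem _ _ ih.2.1

lemma contract_mem_pow (A : GrSpace.{u, v} k) (i j : ℤ) (φ : Module.Dual k A) (p : ℕ)
    {a : GSym A} (ha : a ∈ pow A (p + 1)) : contract A i j φ a ∈ pow A p :=
  (contractHom_lower A i j φ (p + 1) a ha).2.2.2.2 p rfl

lemma induction {A : GrSpace.{u, v} k} {P : GSym A → Prop} (a : GSym A)
    (hc : ∀ r, P (algebraMap k _ r)) (hι : ∀ y, P (ι A y)) (hm : ∀ b c, P b → P c → P (b * c))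
    (ha : ∀ b c, P b → P c → P (b + c)) : P a := by
  obtain ⟨t, rfl⟩ := RingQuot.mkAlgHom_surjective k (Rel A) a
  induction t using TensorAlgebra.induction with
  | algebraMap r => simpa using hc r
  | ι y => exact hι y
  | mul b c hb hc => rw [map_mul]; exact hm _ _ hb hc
  | add b c hb hc => rw [map_add]; exact ha _ _ hb hc

lemma contractHom_indep (A : GrSpace.{u, v} k) (i j : ℤ) (φ ψ : Module.Dual k A) (a : GSym A) :
    contractHom A i j φ a 0 0 = contractHom A i j ψ a 0 0 ∧
      contractHom A i j φ a 1 1 = contractHom A i j ψ a 1 1 ∧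
      contractHom A i j φ a 1 0 = 0 ∧ contractHom A i j ψ a 1 0 = 0 := by
  induction a using GSym.induction with
  | hc r => simp [Matrix.algebraMap_matrix_apply]
  | hι y => simp [contractHom_ι]
  | hm b c hb hc =>
    simp [Matrix.mul_apply, Fin.sum_univ_two, hb.1, hb.2.1, hb.2.2.1, hb.2.2.2, hc.1, hc.2.1,
      hc.2.2.1, hc.2.2.2]
  | ha b c hb hc =>
    simp [hb.1, hb.2.1, hb.2.2.1, hb.2.2.2, hc.1, hc.2.1, hc.2.2.1, hc.2.2.2]

lemma contract_mul (A : GrSpace.{u, v} k) (i j : ℤ) (φ : Module.Dual k A) (a b : GSym A) :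
    contract A i j φ (a * b) =
      contractHom A i j 0 a 0 0 * contract A i j φ b +
        contract A i j φ a * contractHom A i j 0 b 1 1 := by
  simp only [contract, LinearMap.coe_mk, AddHom.coe_mk, map_mul, Matrix.mul_apply,
    Fin.sum_univ_two]
  rw [(contractHom_indep A i j φ 0 a).1, (contractHom_indep A i j φ 0 b).2.1]

lemma contract_linear (A : GrSpace.{u, v} k) (i j : ℤ) (r : k) (φ ψ : Module.Dual k A)
    (a : GSym A) :
    contract A i j (r • φ + ψ) a = r • contract A i j φ a + contract A i j ψ a := by
  induction a using GSym.induction with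
  | hc r => simp [contract, Matrix.algebraMap_matrix_apply]
  | hι y => simp [contract, contractHom_ι, Algebra.smul_def]
  | hm b c hb hc =>
    simp only [contract_mul, hb, hc, mul_add, add_mul, smul_add, mul_smul_comm, smul_mul_assoc]
    abel
  | ha b c hb hc =>
    simp only [map_add, hb, hc, smul_add]
    abel

/-- The contraction `∂_φ` of `Sym(A)` with a functional `φ`: the left derivation with
`∂_φ (a) = φ a` on generators, so that
`∂_φ (a b) = ∂_φ(a) b + (-1) ^ (|φ| |a|) a ∂_φ(b)`. -/
def leftDeriv (A : GrSpace.{u, v} k) (φ : Module.Dual k A) : GSym A →ₗ[k] GSym A :=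
  contract A 0 0 φ + contract A 1 0 φ

/-- The right derivation with the value `φ a` on generators:
`(a b)∂_φ = a (b ∂_φ) + (-1) ^ (|φ| |b|) (a ∂_φ) b`. -/
def rightDeriv (A : GrSpace.{u, v} k) (φ : Module.Dual k A) : GSym A →ₗ[k] GSym A :=
  contract A 0 0 φ + contract A 0 1 φ

/-- The algebra map `Sym(A ⊕ B) → Sym(A ⊕ B)[t]`, `a ↦ a`, `b ↦ t b`. -/
def weightHom (A : GrSpace.{u, v} k) (B : GrSpace.{u, w} k) :
    GSym (A.prod B) →ₐ[k] (GSym (A.prod B))[X] :=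
  lift
    { toFun := fun y : A × B => Polynomial.C (ι (A.prod B) (y.1, 0)) +
        Polynomial.X * Polynomial.C (ι (A.prod B) (0, y.2))
      map_add' := fun y z => by
        have h1 : ((y + z).1, (0 : B)) = (y.1, 0) + (z.1, 0) := by simp
        have h2 : ((0 : A), (y + z).2) = (0, y.2) + (0, z.2) := by simp
        rw [h1, h2, map_add, map_add, map_add, map_add, mul_add]
        abel
      map_smul' := fun c y => by
        have h1 : ((c • y).1, (0 : B)) = c • (y.1, 0) := by simp
        have h2 : ((0 : A), (c • y).2) = c • (0, y.2) := by simp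
        rw [h1, h2, LinearMap.map_smul, LinearMap.map_smul, RingHom.id_apply, smul_add,
          ← Polynomial.smul_C, ← Polynomial.smul_C, mul_smul_comm] } (by
    intro d e y hy z hz
    have hc : ∀ p ∈ (A.prod B).gr d, ∀ q ∈ (A.prod B).gr e,
        (Polynomial.C (ι (A.prod B) p) * Polynomial.C (ι (A.prod B) q) : (GSym (A.prod B))[X])
          = ksign k (d * e) • (Polynomial.C (ι (A.prod B) q) * Polynomial.C (ι (A.prod B) p)) := by
      intro p hp q hq
      rw [← Polynomial.C_mul, ι_comm _ hp hq, ← Polynomial.C_mul, ← Polynomial.smul_C]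
    have hX : ∀ F : (GSym (A.prod B))[X], F * Polynomial.X = Polynomial.X * F :=
      fun F => (Polynomial.X_mul (p := F)).symm
    have y1 : (y.1, (0 : B)) ∈ (A.prod B).gr d := ⟨hy.1, zero_mem _⟩
    have y2 : ((0 : A), y.2) ∈ (A.prod B).gr d := ⟨zero_mem _, hy.2⟩
    have z1 : (z.1, (0 : B)) ∈ (A.prod B).gr e := ⟨hz.1, zero_mem _⟩
    have z2 : ((0 : A), z.2) ∈ (A.prod B).gr e := ⟨zero_mem _, hz.2⟩
    have comm1 : ∀ F G : (GSym (A.prod B))[X], F * (Polynomial.X * G) = Polynomial.X * (F * G) :=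
      fun F G => by rw [← mul_assoc, hX, mul_assoc]
    simp only [LinearMap.coe_mk, AddHom.coe_mk, mul_add, add_mul, comm1, mul_assoc,
      hc _ y1 _ z1, hc _ y1 _ z2, hc _ y2 _ z1, hc _ y2 _ z2, smul_add, mul_smul_comm]
    abel)

/-- The part of weight `j` in the generators from `B`, of an element of `Sym(A ⊕ B)`. -/
def weightPart (A : GrSpace.{u, v} k) (B : GrSpace.{u, w} k) (j : ℕ) :
    GSym (A.prod B) →ₗ[k] GSym (A.prod B) where
  toFun a := (weightHom A B a).coeff j
  map_add' a b := by simp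
  map_smul' c a := by simp

lemma weightPart_mem_pow (A : GrSpace.{u, v} k) (B : GrSpace.{u, w} k) (j p : ℕ)
    {a : GSym (A.prod B)} (ha : a ∈ pow (A.prod B) p) :
    weightPart A B j a ∈ pow (A.prod B) p := by
  unfold pow at ha
  induction ha using Submodule.pow_induction_on_left' generalizing j with
  | algebraMap r =>
    simp only [weightPart, LinearMap.coe_mk, AddHom.coe_mk, AlgHom.commutes,
      Polynomial.algebraMap_apply, Polynomial.coeff_C, pow, pow_zero]
    split_ifs
    · exact Submodule.algebraMap_mem r
    · exact zero_mem _
  | add b c p hb hc ihb ihc =>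
    rw [map_add]; exact add_mem (ihb j) (ihc j)
  | mem_mul m hm p b hb ih =>
    obtain ⟨y, rfl⟩ := hm
    have hmul : ∀ (z : A.prod B) (c : GSym (A.prod B)), c ∈ pow (A.prod B) p →
        ι (A.prod B) z * c ∈ pow (A.prod B) (p + 1) := by
      intro z c hc
      rw [pow, pow_succ']
      exact Submodule.mul_mem_mul ⟨z, rfl⟩ hc
    have h1 : weightHom A B (ι (A.prod B) y) = Polynomial.C (ι (A.prod B) (y.1, 0)) +
        Polynomial.X * Polynomial.C (ι (A.prod B) (0, y.2)) := lift_ι _ _ y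
    have h2 : weightPart A B j (ι (A.prod B) y * b)
        = ι (A.prod B) (y.1, 0) * weightPart A B j b +
          (Polynomial.X * (Polynomial.C (ι (A.prod B) (0, y.2)) * weightHom A B b)).coeff j := by
      simp only [weightPart, LinearMap.coe_mk, AddHom.coe_mk, map_mul, h1, add_mul, mul_assoc,
        Polynomial.coeff_add, Polynomial.coeff_C_mul]
    rw [h2]
    refine add_mem (hmul _ _ (ih j)) ?_
    rcases j with _ | j
    · simp
    · rw [Polynomial.coeff_X_mul, Polynomial.coeff_C_mul]
      exact hmul _ _ (ih j)

end GSym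

/-- The completed graded symmetric algebra `∏_p Sym^p(A)`, realised as the algebra of formal power
series `∑ F_p t^p` over `Sym(A)` with `F_p ∈ Sym^p(A)`. -/
def CSym {k : Type u} [Field k] (A : GrSpace.{u, v} k) : Subalgebra k (PowerSeries (GSym A)) where
  carrier := {F | ∀ p, PowerSeries.coeff p F ∈ GSym.pow A p}
  mul_mem' {F G} hF hG p := by
    rw [PowerSeries.coeff_mul]
    refine sum_mem fun q hq => ?_
    rw [← Finset.HasAntidiagonal.mem_antidiagonal.1 hq, GSym.pow, pow_add]
    exact Submodule.mul_mem_mul (hF _) (hG _)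
  add_mem' {F G} hF hG p := by
    rw [map_add]; exact add_mem (hF p) (hG p)
  algebraMap_mem' r p := by
    rw [PowerSeries.algebraMap_apply, PowerSeries.coeff_C]
    split_ifs with h
    · subst h
      rw [GSym.pow, pow_zero]; exact Submodule.algebraMap_mem r
    · exact zero_mem _

namespace CSym

variable {k : Type u} [Field k]

/-- The component `F_p ∈ Sym^p(A)`. -/
def coeff {A : GrSpace.{u, v} k} (p : ℕ) (F : CSym A) : GSym A := PowerSeries.coeff p F.1

def ofCoeff {A : GrSpace.{u, v} k} (c : ℕ → GSym A) (hc : ∀ p, c p ∈ GSym.pow A p) : CSym A :=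
  ⟨PowerSeries.mk c, fun p => by rw [PowerSeries.coeff_mk]; exact hc p⟩

/-- The extension to the completion of a linear map sending `Sym^(p+s)` to `Sym^p` for all `p`. -/
def extend {A : GrSpace.{u, v} k} {B : GrSpace.{u, w} k} (s : ℕ) (T : GSym A →ₗ[k] GSym B)
    (hT : ∀ p, ∀ a ∈ GSym.pow A (p + s), T a ∈ GSym.pow B p) : CSym A →ₗ[k] CSym B where
  toFun F := ofCoeff (fun p => T (coeff (p + s) F)) fun p => hT p _ (F.2 (p + s))
  map_add' F G := by
    refine Subtype.ext (PowerSeries.ext fun p => ?_)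
    simp [ofCoeff, coeff]
  map_smul' r F := by
    refine Subtype.ext (PowerSeries.ext fun p => ?_)
    simp [ofCoeff, coeff]

/-- The inclusion of the generators. -/
def gen (A : GrSpace.{u, v} k) (a : A) : CSym A :=
  ofCoeff (fun p => if p = 1 then GSym.ι A a else 0) fun p => by
    split_ifs with h
    · subst h
      rw [GSym.pow, pow_one]; exact ⟨a, rfl⟩
    · exact zero_mem _

/-- `F` has cohomological degree `d`. -/
def IsHomog {A : GrSpace.{u, v} k} (d : ℤ) (F : CSym A) : Prop :=
  ∀ p, coeff p F ∈ GSym.homog A d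

def map {A : GrSpace.{u, v} k} {B : GrSpace.{u, w} k} (f : GrHom A B) : CSym A →ₗ[k] CSym B :=
  extend 0 (GSym.map f).toLinearMap fun p _ ha => GSym.map_mem_pow f p ha

def leftDeriv {A : GrSpace.{u, v} k} (φ : Module.Dual k A) : CSym A →ₗ[k] CSym A :=
  extend 1 (GSym.leftDeriv A φ) fun p _ ha =>
    add_mem (GSym.contract_mem_pow A 0 0 φ p ha) (GSym.contract_mem_pow A 1 0 φ p ha)

def rightDeriv {A : GrSpace.{u, v} k} (φ : Module.Dual k A) : CSym A →ₗ[k] CSym A :=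
  extend 1 (GSym.rightDeriv A φ) fun p _ ha =>
    add_mem (GSym.contract_mem_pow A 0 0 φ p ha) (GSym.contract_mem_pow A 0 1 φ p ha)

lemma rightDeriv_linear {A : GrSpace.{u, v} k} (r : k) (φ ψ : Module.Dual k A) (F : CSym A) :
    rightDeriv (r • φ + ψ) F = r • rightDeriv φ F + rightDeriv ψ F := by
  refine Subtype.ext (PowerSeries.ext fun p => ?_)
  simp [rightDeriv, extend, ofCoeff, GSym.rightDeriv, GSym.contract_linear, smul_add]
  abel

lemma rightDeriv_add {A : GrSpace.{u, v} k} (φ ψ : Module.Dual k A) (F : CSym A) :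
    rightDeriv (φ + ψ) F = rightDeriv φ F + rightDeriv ψ F := by
  simpa using rightDeriv_linear 1 φ ψ F

lemma rightDeriv_smul {A : GrSpace.{u, v} k} (r : k) (φ : Module.Dual k A) (F : CSym A) :
    rightDeriv (r • φ) F = r • rightDeriv φ F := by
  have h0 : rightDeriv (0 : Module.Dual k A) F = 0 := by
    simpa using rightDeriv_add (0 : Module.Dual k A) 0 F
  simpa [h0] using rightDeriv_linear r φ 0 F

end CSym

/-! ### Formal moduli problems, through their `L_∞` algebras

A formal moduli problem `X` is represented by the underlying graded vector space `G` of the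
`L_∞` algebra `𝔤 = T_o[-1] X`. -/

section Formal

variable {k : Type u} [Field k]

/-- The formal functions `O(X) = Sym^(𝔤*[-1])`; note that `𝔤*[-1] = (𝔤[1])*`. -/
abbrev Fun (G : GrSpace.{u, v} k) : Subalgebra k (PowerSeries (GSym (G.shift 1).dual)) :=
  CSym (G.shift 1).dual

/-- A vector field on `X`: an element of `∏_p Hom(Sym^p(𝔤[1]), 𝔤[1])`, given by its values on
the linear coordinate functions. -/
abbrev VectorField (G : GrSpace.{u, v} k) : Type (max u v) := (G.shift 1).dual →ₗ[k] Fun G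

/-- The left derivative of a function in the direction of the constant vector field `y ∈ 𝔤[1]`. -/
def dirDeriv {G : GrSpace.{u, v} k} (y : G) : Fun G →ₗ[k] Fun G :=
  CSym.leftDeriv (A := (G.shift 1).dual) (Module.Dual.eval k G y)

/-- The right derivative of a function in the direction of the constant vector field `y ∈ 𝔤[1]`. -/
def dirDerivRight {G : GrSpace.{u, v} k} (y : G) : Fun G →ₗ[k] Fun G :=
  CSym.rightDeriv (A := (G.shift 1).dual) (Module.Dual.eval k G y)

namespace VectorField

/-- The action of a vector field on functions, `Q(F) = ∑_i Q(x^i) ∂F/∂x^i` in linear coordinates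
`x^i` (the sum does not depend on the basis). -/
def act {G : GrSpace.{u, v} k} (Q : VectorField G) (F : Fun G) : Fun G :=
  ∑ i, Q ((Module.finBasis k G).coord i) * dirDeriv (Module.finBasis k G i) F

def IsHomog {G : GrSpace.{u, v} k} (m : ℤ) (Q : VectorField G) : Prop :=
  ∀ d, ∀ ξ ∈ (G.shift 1).dual.gr d, CSym.IsHomog (d + m) (Q ξ)

/-- `Q` is the cohomological vector field (Chevalley-Eilenberg differential) of an `L_∞` algebra
structure on `𝔤`: it has degree `1`, vanishes at the base point, and squares to zero. -/
structure IsLInfinity {G : GrSpace.{u, v} k} (Q : VectorField G) : Prop where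
  degree : Q.IsHomog 1
  base : ∀ ξ, CSym.coeff 0 (Q ξ) = 0
  square : ∀ F, Q.act (Q.act F) = 0

end VectorField

/-- A strict, constant coefficient `n`-shifted symplectic form: a graded symmetric isomorphism
`ω : 𝔤 → 𝔤*[n-2]`. -/
structure ShiftedSymplectic (G : GrSpace.{u, v} k) (n : ℤ) where
  form : G ≃ₗ[k] Module.Dual k G
  degree : ∀ d e, ∀ y ∈ G.gr d, ∀ z ∈ G.gr e, d + e ≠ 2 - n → form y z = 0
  symm : ∀ d e, ∀ y ∈ G.gr d, ∀ z ∈ G.gr e, form y z = ksign k (d * e) * form z y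

namespace ShiftedSymplectic

variable {G : GrSpace.{u, v} k} {n : ℤ}

/-- The same form on `𝔤[1]`, where it is graded antisymmetric: `Ω(y, z) = (-1) ^ |y| ω(y, z)`,
with `|y|` the degree of `y` in `𝔤`. -/
def shifted (ω : ShiftedSymplectic G n) : G →ₗ[k] Module.Dual k G :=
  ω.form.toLinearMap ∘ₗ G.sgn 1

/-- The Hamiltonian vector field `Q_S` of a function `S`, characterised by
`Q_S (Ω(y, ·)) = S ∂_y` (right derivative) for `y ∈ 𝔤[1]`. -/
def hamiltonian (ω : ShiftedSymplectic G n) (S : Fun G) : VectorField G where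
  toFun ξ := dirDerivRight (G.sgn 1 (ω.form.symm ξ)) S
  map_add' ξ η := by
    rw [map_add, map_add, dirDerivRight, map_add]
    exact CSym.rightDeriv_add _ _ S
  map_smul' c ξ := by
    rw [map_smul, map_smul, dirDerivRight, map_smul]
    exact CSym.rightDeriv_smul _ _ S

/-- The Poisson bracket `{S, F}_ω = Q_S(F)`. -/
def bracket (ω : ShiftedSymplectic G n) (S F : Fun G) : Fun G := (ω.hamiltonian S).act F

end ShiftedSymplectic

/-- The pullback of functions along the map of formal moduli problems given by a strict (linear)
map of the `L_∞` algebras. -/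
def pullback {G : GrSpace.{u, v} k} {L : GrSpace.{u, w} k} (f : GrHom L G) :
    Fun G →ₗ[k] Fun L :=
  CSym.map (f.shift 1).dual

/-- `f` is a strict map of `L_∞` algebras: the pullback of functions is a cochain map. -/
def IsStrictMap {G : GrSpace.{u, v} k} {L : GrSpace.{u, w} k} (f : GrHom L G)
    (Q' : VectorField L) (Q : VectorField G) : Prop :=
  ∀ F, pullback f (Q.act F) = Q'.act (pullback f F)

/-! ### Polyvector fields -/

/-- The `(n-1)`-shifted polyvector fields of all degrees on the formal moduli problem `L`,
`∏_j Γ(L, Sym^j(T_L[-n])) = Sym^(𝔩*[-1]) ⊗^ Sym^(𝔩[1-n])`. -/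
abbrev PolyVec (n : ℤ) (L : GrSpace.{u, v} k) :
    Subalgebra k (PowerSeries (GSym ((L.shift 1).dual.prod (L.shift (1 - n))))) :=
  CSym ((L.shift 1).dual.prod (L.shift (1 - n)))

namespace PolyVec

variable {n : ℤ} {L : GrSpace.{u, v} k}

/-- A function as a polyvector field of degree `0`. -/
def ofFun (n : ℤ) (L : GrSpace.{u, v} k) : Fun L →ₗ[k] PolyVec n L :=
  CSym.map (GrHom.inl (L.shift 1).dual (L.shift (1 - n)))

/-- The constant vector field `y`, as a generator in `T_L[-n]`. -/
def θ (n : ℤ) (L : GrSpace.{u, v} k) (y : L) : PolyVec n L :=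
  CSym.gen ((L.shift 1).dual.prod (L.shift (1 - n))) (0, y)

/-- A vector field as a polyvector field of degree `1`: `∑_i Q(x^i) θ_i`. -/
def ofVectorField (n : ℤ) {L : GrSpace.{u, v} k} (Q : VectorField L) : PolyVec n L :=
  ∑ i, ofFun n L (Q ((Module.finBasis k L).coord i)) * θ n L (Module.finBasis k L i)

/-- The space `Γ(L, Sym^j(T_L[-n]))` of polyvector fields of degree `j`. -/
def IsPolyDegree (j : ℕ) (P : PolyVec n L) : Prop :=
  ∀ p, CSym.coeff p P ∈ ⨆ (i : ℕ) (_ : i + j = p),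
    LinearMap.range (GSym.ι ((L.shift 1).dual.prod (L.shift (1 - n))) ∘ₗ
      LinearMap.inl k (Module.Dual k L) L) ^ i *
    LinearMap.range (GSym.ι ((L.shift 1).dual.prod (L.shift (1 - n))) ∘ₗ
      LinearMap.inr k (Module.Dual k L) L) ^ j

/-- The component of polyvector degree `j`. -/
def component (j : ℕ) : PolyVec n L →ₗ[k] PolyVec n L :=
  CSym.extend 0 (GSym.weightPart (L.shift 1).dual (L.shift (1 - n)) j) fun p _ ha =>
    GSym.weightPart_mem_pow _ _ j p ha

/-- The sum `∑_{j ≥ 2} P_j` of a tower of polyvector fields `P_j` of degree `j`; only finitely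
many terms contribute to the component in a given symmetric power. -/
def tower (P : ℕ → PolyVec n L) : PolyVec n L :=
  CSym.ofCoeff (fun p => ∑ j ∈ Finset.Icc 2 p, CSym.coeff p (P j)) fun p =>
    sum_mem fun j _ => (P j).2 p

/-- Derivatives in the direction of `y ∈ 𝔩[1]` (along `L`) and in the direction of a functional
on the fibre coordinates `𝔩[1-n]`. -/
def baseDual (n : ℤ) {L : GrSpace.{u, v} k} (y : L) :
    Module.Dual k ((L.shift 1).dual.prod (L.shift (1 - n))) :=
  Module.Dual.eval k L y ∘ₗ LinearMap.fst k (Module.Dual k L) L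

def fibreDual (n : ℤ) {L : GrSpace.{u, v} k} (η : Module.Dual k L) :
    Module.Dual k ((L.shift 1).dual.prod (L.shift (1 - n))) :=
  η ∘ₗ LinearMap.snd k (Module.Dual k L) L

/-- The Schouten bracket
`[P, R] = ∑_i (P ∂/∂θ_i) (∂/∂x^i R) - (-1) ^ ((n+1) |e_i|) (P ∂/∂x^i) (∂/∂θ_i R)`,
with right derivatives of `P` and left derivatives of `R`, for a basis `e_i` of `𝔩[1]`. It is the
biderivation of degree `-n` which vanishes on pairs of functions, with `[Q, F] = Q(F)` for a vector
field `Q` and a function `F`, and which restricts to the Lie bracket of vector fields. -/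
def schouten (P R : PolyVec n L) : PolyVec n L :=
  ∑ i, (CSym.rightDeriv (fibreDual n ((Module.finBasis k L).coord i)) P *
      CSym.leftDeriv (baseDual n (Module.finBasis k L i)) R -
    CSym.rightDeriv (baseDual (L := L) n ((L.shift 1).sgn (n + 1) (Module.finBasis k L i))) P *
      CSym.leftDeriv (fibreDual n ((Module.finBasis k L).coord i)) R)

/-- A tower `P_j ∈ Γ(L, Sym^j(T_L[-n]))`, `j ≥ 2`, of cohomological degree `n + 1` is an
`(n-1)`-shifted homotopy Poisson structure on the formal moduli problem `L` with cohomological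
vector field `Q` if `[Q + ∑ P_j, Q + ∑ P_j] = 0`. -/
structure IsHomotopyPoisson (Q : VectorField L) (P : ℕ → PolyVec n L) : Prop where
  polyDegree : ∀ j, 2 ≤ j → IsPolyDegree j (P j)
  degree : ∀ j, 2 ≤ j → CSym.IsHomog (n + 1) (P j)
  master : schouten (ofVectorField n Q + tower P) (ofVectorField n Q + tower P) = 0

end PolyVec

/-! ### Regular embedded Lagrangians -/

/-- A Lagrangian `f : 𝔩₊ → 𝔤` (injective, with `ω` vanishing on `𝔩₊`) and a complementary graded
subspace `g : 𝔩₋ → 𝔤` on which `ω` vanishes too. -/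
structure LagrangianSplitting {G : GrSpace.{u, v} k} {n : ℤ} (ω : ShiftedSymplectic G n)
    (Lp : GrSpace.{u, w} k) (Lm : GrSpace.{u, x} k) where
  f : GrHom Lp G
  f_injective : Function.Injective f.lin
  f_isotropic : ∀ a b, ω.form (f.lin a) (f.lin b) = 0
  g : GrHom Lm G
  g_injective : Function.Injective g.lin
  g_isotropic : ∀ a b, ω.form (g.lin a) (g.lin b) = 0
  isCompl : IsCompl (LinearMap.range f.lin) (LinearMap.range g.lin)

namespace LagrangianSplitting

variable {G : GrSpace.{u, v} k} {n : ℤ} {ω : ShiftedSymplectic G n} {Lp : GrSpace.{u, w} k}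
  {Lm : GrSpace.{u, x} k}

/-- The decomposition `𝔩₊ ⊕ 𝔩₋ → 𝔤`. -/
def sumHom (D : LagrangianSplitting ω Lp Lm) : GrHom (Lp.prod Lm) G := D.f.coprod D.g

lemma sumHom_bijective (D : LagrangianSplitting ω Lp Lm) : Function.Bijective D.sumHom.lin := by
  constructor
  · rw [← LinearMap.ker_eq_bot, LinearMap.ker_eq_bot']
    rintro ⟨a, b⟩ h
    have h' : D.f.lin a + D.g.lin b = 0 := h
    have h1 : D.f.lin a ∈ LinearMap.range D.g.lin :=
      ⟨-b, by rw [map_neg]; exact (eq_neg_of_add_eq_zero_left h').symm⟩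
    have h2 : D.f.lin a = 0 := Submodule.disjoint_def.1 D.isCompl.disjoint _ ⟨a, rfl⟩ h1
    rw [h2, zero_add] at h'
    rw [D.f_injective (h2.trans (map_zero _).symm), D.g_injective (h'.trans (map_zero _).symm)]
    rfl
  · intro y
    have : y ∈ LinearMap.range D.f.lin ⊔ LinearMap.range D.g.lin := by
      rw [D.isCompl.sup_eq_top]; trivial
    obtain ⟨_, ⟨a, rfl⟩, _, ⟨b, rfl⟩, rfl⟩ := Submodule.mem_sup.1 this
    exact ⟨(a, b), rfl⟩

/-- The inverse `𝔤 → 𝔩₊ ⊕ 𝔩₋`. -/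
def split (D : LagrangianSplitting ω Lp Lm) : GrHom G (Lp.prod Lm) :=
  D.sumHom.inverse D.sumHom_bijective

lemma split_sumHom (D : LagrangianSplitting ω Lp Lm) (a : Lp) (b : Lm) :
    D.split.lin (D.f.lin a + D.g.lin b) = (a, b) :=
  (LinearEquiv.ofBijective D.sumHom.lin D.sumHom_bijective).symm_apply_apply (a, b)

lemma shifted_isotropic (ω : ShiftedSymplectic G n) {L : GrSpace.{u, w} k} (f : GrHom L G)
    (h : ∀ a b, ω.form (f.lin a) (f.lin b) = 0) (a b : L) :
    ω.shifted (f.lin a) (f.lin b) = 0 := by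
  refine L.induction_gr (p := fun a => ω.shifted (f.lin a) (f.lin b) = 0) a ?_ (by simp) ?_
  · intro d c hc
    rw [ShiftedSymplectic.shifted, LinearMap.comp_apply, GrSpace.sgn,
      diag_of_mem G _ (f.map_gr d c hc), map_smul]
    simp [h]
  · intro c c' hc hc'
    simp [hc, hc']

/-- The linear map `𝔩₊*[-1] ⊕ 𝔩₊[1-n] → 𝔤*[-1]` dual to the isomorphism `𝔤 ≅ 𝔩₊ ⊕ 𝔩₊*[n-2]`
given by the splitting and by `ω|_{𝔩₋} : 𝔩₋ → 𝔩₊*[n-2]`: the pair `(ξ, a)` is sent to the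
functional `(y₊, y₋) ↦ ξ(y₊) + Ω(y₋, a)`. -/
def coordHom (D : LagrangianSplitting ω Lp Lm) :
    GrHom ((Lp.shift 1).dual.prod (Lp.shift (1 - n))) (G.shift 1).dual where
  lin := LinearMap.coprod
    ((LinearMap.fst k Lp Lm ∘ₗ D.split.lin).dualMap)
    ((ω.shifted ∘ₗ D.g.lin ∘ₗ LinearMap.snd k Lp Lm ∘ₗ D.split.lin).flip ∘ₗ D.f.lin)
  map_gr := by
    rintro d ⟨ξ, a⟩ ⟨hξ, ha⟩ e he y hy
    have hs := D.split.map_gr (e + 1) y hy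
    have h1 : ξ (D.split.lin y).1 = 0 := hξ e he _ hs.1
    have h2 : ω.shifted (D.g.lin (D.split.lin y).2) (D.f.lin a) = 0 := by
      have hg := D.g.map_gr _ _ hs.2
      rw [ShiftedSymplectic.shifted, LinearMap.comp_apply, GrSpace.sgn, diag_of_mem G _ hg,
        map_smul, LinearMap.smul_apply, LinearEquiv.coe_coe,
        ω.degree _ _ _ hg _ (D.f.map_gr _ _ ha) (by omega), smul_zero]
    change ξ (D.split.lin y).1 + ω.shifted (D.g.lin (D.split.lin y).2) (D.f.lin a) = 0
    rw [h1, h2, add_zero]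

lemma coordHom_apply (D : LagrangianSplitting ω Lp Lm) (ξ : Module.Dual k Lp) (a : Lp) (y : G) :
    (D.coordHom.lin (ξ, a) : Module.Dual k G) y
      = ξ (D.split.lin y).1 + ω.shifted (D.g.lin (D.split.lin y).2) (D.f.lin a) := rfl

lemma shifted_left_injective (ω : ShiftedSymplectic G n) (z : G)
    (h : ∀ y, ω.shifted y z = 0) : z = 0 := by
  have h' : ∀ d, ∀ y ∈ G.gr d, ω.form y z = 0 := by
    intro d y hy
    have := h y
    rw [ShiftedSymplectic.shifted, LinearMap.comp_apply, GrSpace.sgn, diag_of_mem G _ hy,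
      map_smul, LinearMap.smul_apply, LinearEquiv.coe_coe, smul_eq_mul] at this
    refine (mul_eq_zero.1 this).resolve_left ?_
    rcases Int.even_or_odd (1 * d) with hd | hd
    · rw [ksign_of_even hd]; exact one_ne_zero
    · rw [ksign_of_odd hd]; exact neg_ne_zero.2 one_ne_zero
  have h2 : ∀ y, ω.form y z = 0 := fun y =>
    G.induction_gr (p := fun y => ω.form y z = 0) y h' (by simp) (fun b c hb hc => by simp [hb, hc])
  refine (Module.forall_dual_apply_eq_zero_iff k z).1 fun φ => ?_
  simpa using h2 (ω.form.symm φ)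

lemma coordHom_bijective (D : LagrangianSplitting ω Lp Lm) :
    Function.Bijective D.coordHom.lin := by
  have hf : ∀ a, D.split.lin (D.f.lin a) = (a, 0) := fun a => by
    simpa using D.split_sumHom a 0
  have hg : ∀ b, D.split.lin (D.g.lin b) = (0, b) := fun b => by
    simpa using D.split_sumHom 0 b
  have hff := shifted_isotropic ω D.f D.f_isotropic
  have hgg := shifted_isotropic ω D.g D.g_isotropic
  have hdec : ∀ y, y = D.f.lin (D.split.lin y).1 + D.g.lin (D.split.lin y).2 := fun y =>
    ((LinearEquiv.ofBijective D.sumHom.lin D.sumHom_bijective).apply_symm_apply y).symm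
  constructor
  · rw [← LinearMap.ker_eq_bot, LinearMap.ker_eq_bot']
    rintro ⟨ξ, a⟩ h
    have h' : ∀ y, ξ (D.split.lin y).1 + ω.shifted (D.g.lin (D.split.lin y).2) (D.f.lin a) = 0 :=
      fun y => by rw [← D.coordHom_apply, h]; rfl
    have h1 : ξ = 0 := LinearMap.ext fun b => by simpa [hf] using h' (D.f.lin b)
    have h2 : D.f.lin a = 0 := by
      refine shifted_left_injective ω _ fun y => ?_
      rw [hdec y, map_add, LinearMap.add_apply, hff, zero_add]
      simpa [h1] using h' y
    rw [h1, D.f_injective (h2.trans (map_zero _).symm)]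
    rfl
  · intro φ
    let φ' : Module.Dual k G := φ - D.coordHom.lin (φ.comp D.f.lin, 0)
    have hinj : Function.Injective (ω.shifted.flip) := by
      rw [← LinearMap.ker_eq_bot, LinearMap.ker_eq_bot']
      intro z hz
      exact shifted_left_injective ω z fun y => by
        rw [← LinearMap.flip_apply, hz]; rfl
    have hsurj := (LinearMap.injective_iff_surjective_of_finrank_eq_finrank
      (Subspace.dual_finrank_eq (K := k) (V := G)).symm).1 hinj
    obtain ⟨z, hz⟩ := hsurj φ'
    have hz' : ∀ y, ω.shifted y z = φ y - φ (D.f.lin (D.split.lin y).1) := fun y => by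
      rw [← LinearMap.flip_apply, hz]
      change φ y - (D.coordHom.lin (φ.comp D.f.lin, 0) : Module.Dual k G) y = _
      rw [coordHom_apply]; simp
    have hm : D.g.lin (D.split.lin z).2 = 0 := by
      refine shifted_left_injective ω _ fun y => ?_
      rw [hdec y, map_add, LinearMap.add_apply, hgg, add_zero]
      have := hz' (D.f.lin (D.split.lin y).1)
      rw [hdec z, map_add, hff, zero_add] at this
      rw [this, hf, sub_self]
    refine ⟨(φ.comp D.f.lin, (D.split.lin z).1), LinearMap.ext fun y => ?_⟩
    rw [coordHom_apply]
    have h3 : D.f.lin (D.split.lin z).1 = z := by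
      conv_rhs => rw [hdec z, hm, add_zero]
    rw [h3, hz', hg]
    have := hdec y
    simp only [map_zero, sub_zero]
    conv_rhs => rw [this]
    simp

/-- The identification of `O(X) = Sym^(𝔤*[-1])` with the polyvector fields
`Sym^(𝔩₊*[-1]) ⊗^ Sym^(𝔩₊[1-n])` on `L₊`, induced by `𝔤 ≅ 𝔩₊ ⊕ 𝔩₊*[n-2]`. -/
def toPolyVec (D : LagrangianSplitting ω Lp Lm) : Fun G →ₗ[k] PolyVec n Lp :=
  CSym.map (D.coordHom.inverse D.coordHom_bijective)

end LagrangianSplitting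

end Formal

end

/-!
The splitting `𝔤 = 𝔩₊ ⊕ 𝔩₋` together with `𝔩₋ ≅ 𝔩₊*[n-2]` gives linear coordinates on `𝔤[1]` in
which the constant form `Ω` is canonical, so `Φ`, being induced by a linear change of coordinates,
intertwines `{·, ·}_ω` with the Schouten bracket.

* `S₀` is the restriction of `S` to `L₊`. Its derivatives are the components of `Q_S` conormal to
  `L₊`, which vanish on `L₊` since `𝔩₊ → 𝔤` is strict; by Euler's identity `S₀` is constant, hence
  zero.
* The fibre derivatives of `Φ(S)` along `θ = 0` are the tangential components of `Q_S` on `L₊`, so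
  `S₁ = Q_{𝔩₊}`.
* In Euler's formula `E S = ∑ᵢ (S ∂ᵢ) xⁱ` the `S ∂ᵢ` are values of `Q_S` on linear coordinates,
  which `Q_S` kills because `Q_S² = 0`; applying `Q_S` therefore gives `{S, E S} = {S, S}`. As
  `E {S, S} = {E S, S} + {S, E S} - 2 {S, S}` and the bracket is symmetric in degree `n + 1`, it
  follows that `E {S, S} = 0`. So `{S, S}` is constant, and its constant term vanishes because `S`
  has no linear term.
-/

noncomputable section

open GrSpace

lemma sum_apply_apply_eq_of_sum_smul_eq {R V W M κ κ' : Type*} [CommRing R] [AddCommGroup V]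
    [Module R V] [Module.Free R V] [Module.Finite R V] [AddCommGroup W] [Module R W]
    [AddCommGroup M] [Module R M] [Fintype κ] [Fintype κ'] (ξ : κ → Module.Dual R V) (y : κ → W)
    (ξ' : κ' → Module.Dual R V) (y' : κ' → W)
    (h : ∀ z, ∑ j, ξ j z • y j = ∑ i, ξ' i z • y' i) (B : Module.Dual R V →ₗ[R] W →ₗ[R] M) :
    ∑ j, B (ξ j) (y j) = ∑ i, B (ξ' i) (y' i) := by
  have htensor : ∑ j, ξ j ⊗ₜ[R] y j = ∑ i, ξ' i ⊗ₜ[R] y' i :=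
    (dualTensorHomEquiv R V W).injective (LinearMap.ext fun z => by simpa using h z)
  simpa using congrArg (TensorProduct.lift B) htensor

namespace GrSpace

variable {k : Type u} [Field k]

lemma ksign_zero : ksign k 0 = 1 := ksign_of_even Even.zero

lemma ksign_add (a b : ℤ) : ksign k (a + b) = ksign k a * ksign k b := by
  simp [ksign, Int.negOnePow_add]

lemma ksign_congr {a b : ℤ} (h : Even (a - b)) : ksign k a = ksign k b := by
  rw [ksign, ksign, (Int.negOnePow_eq_iff a b).2 h]

lemma ksign_mul_self (a : ℤ) : ksign k a * ksign k a = 1 := by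
  rw [← ksign_add, ksign_of_even ⟨a, rfl⟩]

lemma linearMap_ext (A : GrSpace.{u, v} k) {M : Type w} [AddCommMonoid M] [Module k M]
    {f g : A →ₗ[k] M} (h : ∀ d, ∀ a ∈ A.gr d, f a = g a) : f = g :=
  LinearMap.ext fun a => A.induction_gr (p := fun a => f a = g a) a h (by simp)
    fun _ _ hb hc => by rw [map_add, map_add, hb, hc]

lemma map_diag {A : GrSpace.{u, v} k} {B : GrSpace.{u, w} k} (f : GrHom A B) (c : ℤ → k) :
    f.lin ∘ₗ A.diag c = B.diag c ∘ₗ f.lin :=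
  A.linearMap_ext fun d a ha => by simp [diag_of_mem A c ha, diag_of_mem B c (f.map_gr d a ha)]

lemma parity_add_parity (A : GrSpace.{u, v} k) : A.parity 0 + A.parity 1 = LinearMap.id :=
  A.linearMap_ext fun d a ha => by
    rcases Int.even_or_odd d with hd | hd <;>
      simp [parity, diag_of_mem A _ ha, hd]

lemma parity_congr (A : GrSpace.{u, v} k) {ε ε' : ℤ} (h : Even (ε - ε')) :
    A.parity ε = A.parity ε' :=
  A.linearMap_ext fun d a ha => by
    have : Even (d + ε) ↔ Even (d + ε') := by grind
    simp [parity, diag_of_mem A _ ha, this]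

lemma sgn_congr (A : GrSpace.{u, v} k) {i j : ℤ} (h : Even (i - j)) : A.sgn i = A.sgn j :=
  A.linearMap_ext fun d a ha => by
    rw [sgn, sgn, diag_of_mem A _ ha, diag_of_mem A _ ha,
      ksign_congr (k := k) (by rw [← sub_mul]; exact h.mul_right d)]

lemma sgn_zero (A : GrSpace.{u, v} k) : A.sgn 0 = LinearMap.id :=
  A.linearMap_ext fun d a ha => by simp [sgn, diag_of_mem A _ ha, ksign_zero]

lemma comp_parity_eq_zero {A : GrSpace.{u, v} k} {d : ℤ} {φ : Module.Dual k A}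
    (hφ : φ ∈ A.dual.gr d) {ε : ℤ} (h : ¬ Even (d + ε)) : φ ∘ₗ A.parity ε = 0 :=
  A.linearMap_ext fun e a ha => by
    by_cases he : e = -d
    · have : ¬ Even (e + ε) := by grind
      simp [parity, diag_of_mem A _ ha, this]
    · simp [parity, diag_of_mem A _ ha, apply_ite φ, hφ e he a ha]

lemma eval_mem_gr {A : GrSpace.{u, v} k} {d : ℤ} {y : A} (hy : y ∈ A.gr d) :
    Module.Dual.eval k A y ∈ A.dual.dual.gr d :=
  fun e he φ hφ => hφ d (by omega) y hy

lemma exists_homogeneous_basis (A : GrSpace.{u, v} k) :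
    ∃ (m : ℕ) (b : Module.Basis (Fin m) k A) (d : Fin m → ℤ), ∀ i, b i ∈ A.gr (d i) := by
  let b := A.internal.collectedBasis fun d => Module.finBasis k (A.gr d)
  have : Fintype (Σ d, Fin (Module.finrank k (A.gr d))) :=
    Module.Basis.fintypeIndexOfRankLtAleph0 b (Module.rank_lt_aleph0 k A)
  let e := Fintype.equivFin (Σ d, Fin (Module.finrank k (A.gr d)))
  refine ⟨_, b.reindex e, fun i => (e.symm i).1, fun i => ?_⟩
  rw [Module.Basis.reindex_apply]
  exact A.internal.collectedBasis_mem _ _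

lemma exists_homogeneous_basis_shift (A : GrSpace.{u, v} k) (j : ℤ) :
    ∃ (m : ℕ) (b : Module.Basis (Fin m) k A) (d : Fin m → ℤ), ∀ i, b i ∈ (A.shift j).gr (d i) :=
  (A.shift j).exists_homogeneous_basis

lemma coord_mem_gr {A : GrSpace.{u, v} k} {κ : Type*} (b : Module.Basis κ k A) {d : κ → ℤ}
    (hb : ∀ i, b i ∈ A.gr (d i)) (i : κ) : b.coord i ∈ A.dual.gr (-d i) := by
  classical
  intro e he a ha
  have hproj : b.coord i ∘ₗ A.proj e = 0 := b.ext fun j => by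
    rw [LinearMap.comp_apply, A.proj_of_mem (hb j)]
    split_ifs with hj
    · have : j ≠ i := by rintro rfl; exact he (by omega)
      simp [this]
    · simp
  simpa [A.proj_of_mem ha] using LinearMap.congr_fun hproj a

end GrSpace

namespace GrHom

variable {k : Type u} [Field k]

lemma ext {A : GrSpace.{u, v} k} {B : GrSpace.{u, w} k} {f g : GrHom A B} (h : f.lin = g.lin) :
    f = g := by
  cases f
  congr

/-- The first projection, as a degree-preserving map. -/
@[reducible] def fst (A : GrSpace.{u, v} k) (B : GrSpace.{u, w} k) : GrHom (A.prod B) A where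
  lin := LinearMap.fst k A B
  map_gr _ _ ha := ha.1

/-- The second projection, as a degree-preserving map. -/
@[reducible] def snd (A : GrSpace.{u, v} k) (B : GrSpace.{u, w} k) : GrHom (A.prod B) B where
  lin := LinearMap.snd k A B
  map_gr _ _ ha := ha.2

/-- The identity, as a degree-preserving map. -/
@[reducible] def id (A : GrSpace.{u, v} k) : GrHom A A where
  lin := LinearMap.id
  map_gr _ _ ha := ha

/-- The composition `g ∘ f` of degree-preserving maps. -/
@[reducible] def comp {A : GrSpace.{u, v} k} {B : GrSpace.{u, w} k} {C : GrSpace.{u, x} k}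
    (g : GrHom B C) (f : GrHom A B) : GrHom A C where
  lin := g.lin ∘ₗ f.lin
  map_gr d a ha := g.map_gr d _ (f.map_gr d a ha)

/-- `GrSpace.sgn` as a degree-preserving map; `GSym.map (sgn A i)` is the `i`-th power of the
parity involution of `Sym(A)`. -/
@[reducible] def sgn (A : GrSpace.{u, v} k) (i : ℤ) : GrHom A A where
  lin := A.sgn i
  map_gr d a ha := by
    rw [GrSpace.sgn, diag_of_mem A _ ha]
    exact Submodule.smul_mem _ _ ha

end GrHom

namespace GSym

variable {k : Type u} [Field k] {A : GrSpace.{u, v} k}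

/-! ### Homogeneous elements and functoriality -/

lemma one_mem_homog : (1 : GSym A) ∈ homog A 0 :=
  Submodule.subset_span ⟨[], by simp, by simp, by simp⟩

lemma algebraMap_mem_homog (c : k) : algebraMap k (GSym A) c ∈ homog A 0 := by
  rw [Algebra.algebraMap_eq_smul_one]
  exact Submodule.smul_mem _ _ one_mem_homog

lemma ι_mem_homog {d : ℤ} {y : A} (hy : y ∈ A.gr d) : ι A y ∈ homog A d :=
  Submodule.subset_span ⟨[(d, y)], by simpa using hy, by simp, by simp⟩

lemma ι_mul_mem_homog {d e : ℤ} {y : A} (hy : y ∈ A.gr d) {b : GSym A} (hb : b ∈ homog A e) :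
    ι A y * b ∈ homog A (d + e) := by
  induction hb using Submodule.span_induction with
  | mem b h =>
    obtain ⟨l, hl, rfl, rfl⟩ := h
    exact Submodule.subset_span ⟨(d, y) :: l, List.forall_mem_cons.2 ⟨hy, hl⟩, by simp, by simp⟩
  | zero => simp
  | add a b _ _ ha hb => rw [mul_add]; exact add_mem ha hb
  | smul c a _ ha => rw [mul_smul_comm]; exact Submodule.smul_mem _ _ ha

@[elab_as_elim]
lemma homog_induction {motive : ∀ d, ∀ a ∈ homog A d, Prop} (one : motive 0 1 one_mem_homog)
    (ι_mul : ∀ e d y (hy : y ∈ A.gr e) b (hb : b ∈ homog A d), motive d b hb →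
      motive (e + d) (ι A y * b) (ι_mul_mem_homog hy hb))
    (zero : ∀ d, motive d 0 (zero_mem _))
    (add : ∀ d a b ha hb, motive d a ha → motive d b hb → motive d (a + b) (add_mem ha hb))
    (smul : ∀ d (c : k) a ha, motive d a ha → motive d (c • a) (Submodule.smul_mem _ c ha))
    {d : ℤ} {a : GSym A} (ha : a ∈ homog A d) : motive d a ha := by
  induction ha using Submodule.span_induction with
  | mem a h =>
    obtain ⟨l, hl, rfl, rfl⟩ := h
    induction l with
    | nil => simpa using one
    | cons y l ih =>
      obtain ⟨hy, hl⟩ := List.forall_mem_cons.1 hl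
      exact ι_mul _ _ _ hy _ (Submodule.subset_span ⟨l, hl, rfl, rfl⟩) (ih hl)
  | zero => exact zero _
  | add a b ha hb iha ihb => exact add _ a b ha hb iha ihb
  | smul c a ha iha => exact smul _ c a ha iha

lemma ι_mul_comm {d e : ℤ} {y : A} (hy : y ∈ A.gr d) {b : GSym A} (hb : b ∈ homog A e) :
    ι A y * b = ksign k (d * e) • (b * ι A y) := by
  induction hb using homog_induction with
  | one => simp [ksign_zero]
  | ι_mul e m z hz b _ ih =>
    rw [← mul_assoc, ι_comm A hy hz, smul_mul_assoc, mul_assoc, ih, mul_smul_comm, smul_smul,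
      ← mul_assoc, mul_add, ksign_add]
  | zero => simp
  | add _ _ _ _ _ ha hb => rw [mul_add, ha, hb, add_mul, smul_add]
  | smul _ _ _ _ ha => rw [mul_smul_comm, ha, smul_mul_assoc, smul_comm]

lemma homog_comm {d e : ℤ} {a b : GSym A} (ha : a ∈ homog A d) (hb : b ∈ homog A e) :
    a * b = ksign k (d * e) • (b * a) := by
  induction ha using homog_induction with
  | one => simp [ksign_zero]
  | ι_mul d m y hy a _ ih =>
    rw [mul_assoc, ih, mul_smul_comm, ← mul_assoc, ι_mul_comm hy hb, smul_mul_assoc, smul_smul,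
      mul_assoc, add_mul, ksign_add, mul_comm]
  | zero => simp
  | add _ _ _ _ _ ha hb => rw [add_mul, ha, hb, mul_add, smul_add]
  | smul _ _ _ _ ha => rw [smul_mul_assoc, ha, mul_smul_comm, smul_comm]

lemma map_ι {B : GrSpace.{u, w} k} (f : GrHom A B) (a : A) : map f (ι A a) = ι B (f.lin a) :=
  lift_ι _ _ a

lemma map_mem_homog {B : GrSpace.{u, w} k} (f : GrHom A B) {d : ℤ} {a : GSym A}
    (ha : a ∈ homog A d) : map f a ∈ homog B d := by
  induction ha using homog_induction with
  | one => rw [map_one]; exact one_mem_homog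
  | ι_mul e _ y hy _ _ ih =>
    rw [map_mul, map_ι]
    exact ι_mul_mem_homog (f.map_gr e y hy) ih
  | zero => simp
  | add _ _ _ _ _ ha hb => rw [map_add]; exact add_mem ha hb
  | smul _ _ _ _ ha => rw [map_smul]; exact Submodule.smul_mem _ _ ha

lemma algHom_ext {R : Type w} [Ring R] [Algebra k R] {f g : GSym A →ₐ[k] R}
    (h : ∀ y, f (ι A y) = g (ι A y)) : f = g := by
  refine AlgHom.ext fun a => ?_
  induction a using GSym.induction with
  | hc r => rw [AlgHom.commutes, AlgHom.commutes]
  | hι y => exact h y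
  | hm b c hb hc => rw [map_mul, map_mul, hb, hc]
  | ha b c hb hc => rw [map_add, map_add, hb, hc]

lemma map_map {B : GrSpace.{u, w} k} {C : GrSpace.{u, x} k} (g : GrHom B C) (f : GrHom A B)
    (a : GSym A) : map g (map f a) = map (g.comp f) a := by
  have : (map g).comp (map f) = map (g.comp f) := algHom_ext fun y => by simp [map_ι]
  exact DFunLike.congr_fun this a

lemma map_id (a : GSym A) : map (GrHom.id A) a = a := by
  have : map (GrHom.id A) = AlgHom.id k (GSym A) := algHom_ext fun y => by simp [map_ι]
  exact DFunLike.congr_fun this a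

lemma map_sgn_zero (a : GSym A) : map (GrHom.sgn A 0) a = a := by
  rw [show GrHom.sgn A 0 = GrHom.id A from GrHom.ext A.sgn_zero, map_id]

lemma map_sgn_of_homog (i : ℤ) {m : ℤ} {a : GSym A} (ha : a ∈ homog A m) :
    map (GrHom.sgn A i) a = ksign k (i * m) • a := by
  induction ha using homog_induction with
  | one => simp [ksign_zero]
  | ι_mul e m y hy b _ ih =>
    have hs : A.sgn i y = ksign k (i * e) • y := diag_of_mem A _ hy
    simp [map_ι, hs, ih, mul_add, ksign_add, smul_smul, mul_comm]
  | zero => simp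
  | add _ _ _ _ _ ha hb => rw [map_add, ha, hb, smul_add]
  | smul _ _ _ _ ha => rw [map_smul, ha, smul_comm]

lemma map_sgn_map {B : GrSpace.{u, w} k} (f : GrHom A B) (i : ℤ) (a : GSym A) :
    map (GrHom.sgn B i) (map f a) = map f (map (GrHom.sgn A i) a) := by
  rw [map_map, map_map,
    show (GrHom.sgn B i).comp f = f.comp (GrHom.sgn A i) from GrHom.ext (map_diag f _).symm]

/-! ### Derivations of the symmetric algebra -/

lemma contractHom_apply_one_zero (i j : ℤ) (φ : Module.Dual k A) (a : GSym A) :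
    contractHom A i j φ a 1 0 = 0 :=
  (contractHom_indep A i j φ φ a).2.2.1

lemma contractHom_apply_diag (i j : ℤ) (φ : Module.Dual k A) (a : GSym A) :
    contractHom A i j φ a 0 0 = map (GrHom.sgn A i) a ∧
      contractHom A i j φ a 1 1 = map (GrHom.sgn A j) a := by
  induction a using GSym.induction with
  | hc r => simp [Matrix.algebraMap_matrix_apply]
  | hι y => simp [contractHom_ι, map_ι]
  | hm b c hb hc =>
    simp [Matrix.mul_apply, Fin.sum_univ_two, hb.1, hb.2, hc.1, hc.2, contractHom_apply_one_zero]
  | ha b c hb hc => simp [hb.1, hb.2, hc.1, hc.2]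

lemma contract_mul_eq (i j : ℤ) (φ : Module.Dual k A) (a b : GSym A) :
    contract A i j φ (a * b) =
      map (GrHom.sgn A i) a * contract A i j φ b + contract A i j φ a * map (GrHom.sgn A j) b := by
  rw [contract_mul, (contractHom_apply_diag i j 0 a).1, (contractHom_apply_diag i j 0 b).2]

lemma contract_algebraMap (i j : ℤ) (φ : Module.Dual k A) (r : k) :
    contract A i j φ (algebraMap k _ r) = 0 := by
  simp [contract, Matrix.algebraMap_matrix_apply]

lemma contract_ι (i j : ℤ) (φ : Module.Dual k A) (y : A) :
    contract A i j φ (ι A y) = algebraMap k _ (φ (A.parity (i + j) y)) := by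
  simp [contract, contractHom_ι]

lemma contract_congr {i j i' j' : ℤ} (hi : Even (i - i')) (hj : Even (j - j'))
    (φ : Module.Dual k A) : contract A i j φ = contract A i' j' φ := by
  have hhom : contractHom A i j φ = contractHom A i' j' φ := algHom_ext fun y => by
    rw [contractHom_ι, contractHom_ι, A.sgn_congr hi, A.sgn_congr hj,
      A.parity_congr (ε := i + j) (ε' := i' + j') (by grind)]
  exact LinearMap.ext fun a => by simp [contract, hhom]

lemma contract_eq_zero {i j : ℤ} {φ : Module.Dual k A} (h : φ ∘ₗ A.parity (i + j) = 0) :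
    contract A i j φ = 0 := by
  refine LinearMap.ext fun a => ?_
  induction a using GSym.induction with
  | hc r => rw [contract_algebraMap]; rfl
  | hι y => rw [contract_ι, ← LinearMap.comp_apply, h]; simp
  | hm b c hb hc => rw [contract_mul, hb, hc]; simp
  | ha b c hb hc => rw [map_add, hb, hc]; simp

lemma contract_map {B : GrSpace.{u, w} k} (f : GrHom A B) (i j : ℤ) (φ : Module.Dual k B)
    (a : GSym A) : contract B i j φ (map f a) = map f (contract A i j (φ ∘ₗ f.lin) a) := by
  induction a using GSym.induction with
  | hc r => rw [AlgHom.commutes, contract_algebraMap, contract_algebraMap, map_zero]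
  | hι y =>
    have hpar : f.lin (A.parity (i + j) y) = B.parity (i + j) (f.lin y) :=
      LinearMap.congr_fun (map_diag f _) y
    rw [map_ι, contract_ι, contract_ι, AlgHom.commutes, LinearMap.comp_apply, hpar]
  | hm b c hb hc =>
    rw [map_mul, contract_mul_eq, contract_mul_eq, map_add, map_mul, map_mul, hb, hc, map_sgn_map,
      map_sgn_map]
  | ha b c hb hc => simp only [map_add, hb, hc]

lemma leftDeriv_eq_contract {d : ℤ} {φ : Module.Dual k A} (hφ : φ ∈ A.dual.gr d) :
    leftDeriv A φ = contract A d 0 φ := by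
  rcases Int.even_or_odd d with hd | hd
  · rw [leftDeriv, contract_eq_zero (i := 1) (comp_parity_eq_zero hφ (by grind)), add_zero,
      contract_congr (i' := d) (j' := 0) (by grind) (by simp)]
  · rw [leftDeriv, contract_eq_zero (i := 0) (comp_parity_eq_zero hφ (by grind)), zero_add,
      contract_congr (i' := d) (j' := 0) (by grind) (by simp)]

lemma rightDeriv_eq_contract {d : ℤ} {φ : Module.Dual k A} (hφ : φ ∈ A.dual.gr d) :
    rightDeriv A φ = contract A 0 d φ := by
  rcases Int.even_or_odd d with hd | hd
  · rw [rightDeriv, contract_eq_zero (j := 1) (comp_parity_eq_zero hφ (by grind)), add_zero,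
      contract_congr (i' := 0) (j' := d) (by simp) (by grind)]
  · rw [rightDeriv, contract_eq_zero (j := 0) (comp_parity_eq_zero hφ (by grind)), zero_add,
      contract_congr (i' := 0) (j' := d) (by simp) (by grind)]

lemma leftDeriv_map {B : GrSpace.{u, w} k} (f : GrHom A B) (φ : Module.Dual k B) (a : GSym A) :
    leftDeriv B φ (map f a) = map f (leftDeriv A (φ ∘ₗ f.lin) a) := by
  simp [leftDeriv, contract_map]

lemma rightDeriv_map {B : GrSpace.{u, w} k} (f : GrHom A B) (φ : Module.Dual k B) (a : GSym A) :
    rightDeriv B φ (map f a) = map f (rightDeriv A (φ ∘ₗ f.lin) a) := by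
  simp [rightDeriv, contract_map]

lemma leftDeriv_linear (r : k) (φ ψ : Module.Dual k A) (a : GSym A) :
    leftDeriv A (r • φ + ψ) a = r • leftDeriv A φ a + leftDeriv A ψ a := by
  simp only [leftDeriv, LinearMap.add_apply, contract_linear, smul_add]
  abel

lemma rightDeriv_linear (r : k) (φ ψ : Module.Dual k A) (a : GSym A) :
    rightDeriv A (r • φ + ψ) a = r • rightDeriv A φ a + rightDeriv A ψ a := by
  simp only [rightDeriv, LinearMap.add_apply, contract_linear, smul_add]
  abel

lemma rightDeriv_add (φ ψ : Module.Dual k A) (a : GSym A) :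
    rightDeriv A (φ + ψ) a = rightDeriv A φ a + rightDeriv A ψ a := by
  simpa using rightDeriv_linear 1 φ ψ a

lemma rightDeriv_smul (r : k) (φ : Module.Dual k A) (a : GSym A) :
    rightDeriv A (r • φ) a = r • rightDeriv A φ a := by
  have h0 : rightDeriv A (0 : Module.Dual k A) a = 0 := by simpa using rightDeriv_add 0 0 a
  simpa [h0] using rightDeriv_linear r φ 0 a

lemma leftDeriv_algebraMap (φ : Module.Dual k A) (r : k) :
    leftDeriv A φ (algebraMap k _ r) = 0 := by
  simp [leftDeriv, contract_algebraMap]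

lemma rightDeriv_algebraMap (φ : Module.Dual k A) (r : k) :
    rightDeriv A φ (algebraMap k _ r) = 0 := by
  simp [rightDeriv, contract_algebraMap]

lemma leftDeriv_ι (φ : Module.Dual k A) (y : A) :
    leftDeriv A φ (ι A y) = algebraMap k _ (φ y) := by
  have := LinearMap.congr_fun A.parity_add_parity y
  rw [leftDeriv, LinearMap.add_apply, contract_ι, contract_ι, ← map_add, ← map_add]
  simpa using congrArg (algebraMap k (GSym A) ∘ φ) this

lemma rightDeriv_ι (φ : Module.Dual k A) (y : A) :
    rightDeriv A φ (ι A y) = algebraMap k _ (φ y) := by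
  have := LinearMap.congr_fun A.parity_add_parity y
  rw [rightDeriv, LinearMap.add_apply, contract_ι, contract_ι, ← map_add, ← map_add]
  simpa using congrArg (algebraMap k (GSym A) ∘ φ) this

lemma leftDeriv_mul {d : ℤ} {φ : Module.Dual k A} (hφ : φ ∈ A.dual.gr d) {m : ℤ} {a : GSym A}
    (ha : a ∈ homog A m) (b : GSym A) :
    leftDeriv A φ (a * b) = leftDeriv A φ a * b + ksign k (d * m) • (a * leftDeriv A φ b) := by
  rw [leftDeriv_eq_contract hφ, contract_mul_eq, map_sgn_of_homog d ha,
    map_sgn_zero, smul_mul_assoc, add_comm]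

lemma rightDeriv_mul {d : ℤ} {φ : Module.Dual k A} (hφ : φ ∈ A.dual.gr d) {m : ℤ} (a : GSym A)
    {b : GSym A} (hb : b ∈ homog A m) :
    rightDeriv A φ (a * b) = a * rightDeriv A φ b + ksign k (d * m) • (rightDeriv A φ a * b) := by
  rw [rightDeriv_eq_contract hφ, contract_mul_eq, map_sgn_of_homog d hb,
    map_sgn_zero, mul_smul_comm]

lemma leftDeriv_mem_homog {d : ℤ} {φ : Module.Dual k A} (hφ : φ ∈ A.dual.gr d) {m : ℤ}
    {a : GSym A} (ha : a ∈ homog A m) : leftDeriv A φ a ∈ homog A (m + d) := by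
  induction ha using homog_induction with
  | one => rw [← map_one (algebraMap k (GSym A)), leftDeriv_algebraMap]; exact zero_mem _
  | ι_mul e m y hy b hb ih =>
    rw [leftDeriv_mul hφ (ι_mem_homog hy), leftDeriv_ι, ← Algebra.smul_def]
    refine add_mem ?_ (Submodule.smul_mem _ _ (by rw [add_assoc]; exact ι_mul_mem_homog hy ih))
    by_cases he : e = -d
    · rw [he, show -d + m + d = m by ring]
      exact Submodule.smul_mem _ _ hb
    · rw [hφ e he y hy, zero_smul]; exact zero_mem _
  | zero => simp
  | add _ _ _ _ _ ha hb => rw [map_add]; exact add_mem ha hb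
  | smul _ _ _ _ ha => rw [map_smul]; exact Submodule.smul_mem _ _ ha

lemma leftDeriv_eq_rightDeriv {d : ℤ} {φ : Module.Dual k A} (hφ : φ ∈ A.dual.gr d) {m : ℤ}
    {a : GSym A} (ha : a ∈ homog A m) :
    leftDeriv A φ a = ksign k (d * (m + 1)) • rightDeriv A φ a := by
  induction ha using homog_induction with
  | one =>
    rw [← map_one (algebraMap k (GSym A)), leftDeriv_algebraMap, rightDeriv_algebraMap, smul_zero]
  | ι_mul e m y hy b hb ih =>
    have hval : algebraMap k (GSym A) (φ y) * b
        = ksign k (d * (e + m + 1)) • (ksign k (d * m) • (algebraMap k (GSym A) (φ y) * b)) := by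
      by_cases he : e = -d
      · rw [smul_smul, ← ksign_add, ksign_of_even, one_smul]
        subst he
        simp only [Int.even_add, Int.even_mul, even_neg, Int.not_even_one]
        tauto
      · rw [hφ e he y hy, map_zero, zero_mul, smul_zero, smul_zero]
    rw [leftDeriv_mul hφ (ι_mem_homog hy), leftDeriv_ι, rightDeriv_mul hφ _ hb, rightDeriv_ι, ih,
      smul_add, ← hval, mul_smul_comm, smul_smul, ← ksign_add, ← mul_add, ← add_assoc, add_comm]
  | zero => simp
  | add _ _ _ _ _ ha hb => rw [map_add, map_add, ha, hb, smul_add]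
  | smul _ _ _ _ ha => rw [map_smul, map_smul, ha, smul_comm]

lemma rightDeriv_mem_homog {d : ℤ} {φ : Module.Dual k A} (hφ : φ ∈ A.dual.gr d) {m : ℤ}
    {a : GSym A} (ha : a ∈ homog A m) : rightDeriv A φ a ∈ homog A (m + d) := by
  have h : rightDeriv A φ a = ksign k (d * (m + 1)) • leftDeriv A φ a := by
    rw [leftDeriv_eq_rightDeriv hφ ha, smul_smul, ksign_mul_self, one_smul]
  rw [h]
  exact Submodule.smul_mem _ _ (leftDeriv_mem_homog hφ ha)

/-- The bilinear map `(φ, y) ↦ (a ∂_φ) y`. Its value on a tensor `∑ φ_j ⊗ y_j`, seen as an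
endomorphism of `A`, is the value at `a` of the derivation of `Sym(A)` extending it. -/
def rightDerivMul (a : GSym A) : Module.Dual k A →ₗ[k] A →ₗ[k] GSym A :=
  LinearMap.mk₂ k (fun φ y => rightDeriv A φ a * ι A y)
    (fun φ ψ y => by rw [rightDeriv_add, add_mul])
    (fun c φ y => by rw [rightDeriv_smul, smul_mul_assoc])
    (fun φ y z => by rw [map_add, mul_add])
    (fun c φ y => by rw [map_smul, mul_smul_comm])

lemma sum_rightDeriv_mul_ι {κ : Type*} [Fintype κ] (f : GrHom A A) {ξ : κ → Module.Dual k A}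
    {y : κ → A} (h : ∀ z, ∑ j, ξ j z • y j = f.lin z) (a : GSym A) (z : A) :
    ∑ j, rightDeriv A (ξ j) (a * ι A z) * ι A (y j) =
      a * ι A (f.lin z) + (∑ j, rightDeriv A (ξ j) a * ι A (y j)) * ι A z := by
  obtain ⟨m, b, d, hb⟩ := A.exists_homogeneous_basis
  have hf (z : A) : ∑ i, b.coord i z • f.lin (b i) = f.lin z := by
    simp_rw [← map_smul, ← map_sum, Module.Basis.coord_apply, b.sum_repr]
  have hbasis (c : GSym A) : ∑ j, rightDeriv A (ξ j) c * ι A (y j)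
      = ∑ i, rightDeriv A (b.coord i) c * ι A (f.lin (b i)) :=
    sum_apply_apply_eq_of_sum_smul_eq ξ y _ _ (fun z => by rw [h, hf]) (rightDerivMul c)
  rw [hbasis, hbasis]
  induction z using A.induction_gr with
  | hm e z hz =>
    have hterm (i : Fin m) : rightDeriv A (b.coord i) (a * ι A z) * ι A (f.lin (b i))
        = a * ι A (b.coord i z • f.lin (b i)) +
          rightDeriv A (b.coord i) a * ι A (f.lin (b i)) * ι A z := by
      rw [rightDeriv_mul (coord_mem_gr b hb i) a (ι_mem_homog hz), rightDeriv_ι, add_mul,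
        mul_assoc, ← Algebra.smul_def, ← map_smul, smul_mul_assoc, mul_assoc, mul_assoc,
        ι_comm A hz (f.map_gr _ _ (hb i)), mul_smul_comm, smul_smul, ← ksign_add,
        ksign_of_even ⟨0, by ring⟩, one_smul]
    simp_rw [hterm, Finset.sum_add_distrib, ← Finset.mul_sum, ← Finset.sum_mul, ← map_sum, hf]
  | h0 => simp
  | ha z z' hz hz' =>
    simp only [map_add, mul_add, add_mul, Finset.sum_add_distrib, hz, hz']
    abel

lemma sum_rightDeriv_mul_ι_of_mem_pow {κ : Type*} [Fintype κ] {ξ : κ → Module.Dual k A} {y : κ → A}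
    (h : ∀ z, ∑ j, ξ j z • y j = z) {p : ℕ} {a : GSym A} (ha : a ∈ pow A p) :
    ∑ j, rightDeriv A (ξ j) a * ι A (y j) = (p : k) • a := by
  unfold pow at ha
  induction ha using Submodule.pow_induction_on_right' with
  | algebraMap r => simp [rightDeriv_algebraMap]
  | add b c p _ _ ihb ihc =>
    simp only [map_add, add_mul, Finset.sum_add_distrib, ihb, ihc, smul_add]
  | mul_mem p b _ ih m hm =>
    obtain ⟨z, rfl⟩ := hm
    rw [sum_rightDeriv_mul_ι (GrHom.id A) h, ih]
    simp [add_smul, add_comm]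

end GSym

namespace CSym

variable {k : Type u} [Field k] {A : GrSpace.{u, v} k} {B : GrSpace.{u, w} k}

/-! ### Formal functions -/

lemma ext_coeff {F H : CSym A} (h : ∀ p, coeff p F = coeff p H) : F = H :=
  Subtype.ext (PowerSeries.ext h)

lemma coeff_mem_pow (p : ℕ) (F : CSym A) : coeff p F ∈ GSym.pow A p := F.2 p

lemma add_neg_one_smul (F H : CSym A) : F + (-1 : k) • H = F - H := by module

lemma coeff_ofCoeff (c : ℕ → GSym A) (hc : ∀ p, c p ∈ GSym.pow A p) (p : ℕ) :
    coeff p (ofCoeff c hc) = c p := PowerSeries.coeff_mk _ _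

lemma coeff_zero (p : ℕ) : coeff p (0 : CSym A) = 0 := rfl

lemma coeff_one (p : ℕ) : coeff p (1 : CSym A) = if p = 0 then 1 else 0 := PowerSeries.coeff_one p

lemma coeff_add (p : ℕ) (F H : CSym A) : coeff p (F + H) = coeff p F + coeff p H := rfl

lemma coeff_smul (p : ℕ) (c : k) (F : CSym A) : coeff p (c • F) = c • coeff p F := rfl

lemma coeff_sum (p : ℕ) {κ : Type*} (s : Finset κ) (F : κ → CSym A) :
    coeff p (∑ i ∈ s, F i) = ∑ i ∈ s, coeff p (F i) := by
  simp [coeff]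

lemma coeff_mul (p : ℕ) (F H : CSym A) :
    coeff p (F * H) = ∑ q ∈ Finset.HasAntidiagonal.antidiagonal p, coeff q.1 F * coeff q.2 H :=
  PowerSeries.coeff_mul _ _ _

lemma coeff_extend (s : ℕ) (T : GSym A →ₗ[k] GSym B)
    (hT : ∀ p, ∀ a ∈ GSym.pow A (p + s), T a ∈ GSym.pow B p) (p : ℕ) (F : CSym A) :
    coeff p (extend s T hT F) = T (coeff (p + s) F) :=
  coeff_ofCoeff _ (fun p => hT p _ (F.2 (p + s))) p

lemma coeff_map (f : GrHom A B) (p : ℕ) (F : CSym A) :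
    coeff p (map f F) = GSym.map f (coeff p F) := coeff_extend _ _ _ _ _

lemma coeff_leftDeriv (φ : Module.Dual k A) (p : ℕ) (F : CSym A) :
    coeff p (leftDeriv φ F) = GSym.leftDeriv A φ (coeff (p + 1) F) := coeff_extend _ _ _ _ _

lemma coeff_rightDeriv (φ : Module.Dual k A) (p : ℕ) (F : CSym A) :
    coeff p (rightDeriv φ F) = GSym.rightDeriv A φ (coeff (p + 1) F) := coeff_extend _ _ _ _ _

lemma coeff_gen (y : A) (p : ℕ) : coeff p (gen A y) = if p = 1 then GSym.ι A y else 0 :=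
  coeff_ofCoeff _ _ p

lemma coeff_zero_mul_gen (F : CSym A) (y : A) : coeff 0 (F * gen A y) = 0 := by
  simp [coeff_mul, coeff_gen]

lemma coeff_succ_mul_gen (F : CSym A) (y : A) (p : ℕ) :
    coeff (p + 1) (F * gen A y) = coeff p F * GSym.ι A y := by
  rw [coeff_mul, Finset.sum_eq_single (p, 1)]
  · simp [coeff_gen]
  · rintro ⟨q, r⟩ hq hne
    rw [Finset.HasAntidiagonal.mem_antidiagonal] at hq
    have hr : r ≠ 1 := by grind
    simp [coeff_gen, hr]
  · simp

lemma map_mul (f : GrHom A B) (F H : CSym A) : map f (F * H) = map f F * map f H := by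
  refine ext_coeff fun p => ?_
  simp only [coeff_map, coeff_mul, map_sum, _root_.map_mul]

lemma map_map {C : GrSpace.{u, x} k} (g : GrHom B C) (f : GrHom A B) (F : CSym A) :
    map g (map f F) = map (g.comp f) F := by
  refine ext_coeff fun p => ?_
  simp only [coeff_map, GSym.map_map]

lemma map_id (F : CSym A) : map (GrHom.id A) F = F := by
  refine ext_coeff fun p => ?_
  rw [coeff_map, GSym.map_id]

lemma map_gen (f : GrHom A B) (y : A) : map f (gen A y) = gen B (f.lin y) := by
  refine ext_coeff fun p => ?_
  simp only [coeff_map, coeff_gen, apply_ite (GSym.map f), GSym.map_ι, map_zero]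

lemma leftDeriv_map (f : GrHom A B) (φ : Module.Dual k B) (F : CSym A) :
    leftDeriv φ (map f F) = map f (leftDeriv (φ ∘ₗ f.lin) F) := by
  refine ext_coeff fun p => ?_
  simp only [coeff_leftDeriv, coeff_map, GSym.leftDeriv_map]

lemma rightDeriv_map (f : GrHom A B) (φ : Module.Dual k B) (F : CSym A) :
    rightDeriv φ (map f F) = map f (rightDeriv (φ ∘ₗ f.lin) F) := by
  refine ext_coeff fun p => ?_
  simp only [coeff_rightDeriv, coeff_map, GSym.rightDeriv_map]

lemma leftDeriv_linear (r : k) (φ ψ : Module.Dual k A) (F : CSym A) :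
    leftDeriv (r • φ + ψ) F = r • leftDeriv φ F + leftDeriv ψ F := by
  refine ext_coeff fun p => ?_
  simp only [coeff_leftDeriv, coeff_add, coeff_smul, GSym.leftDeriv_linear]

lemma leftDeriv_add (φ ψ : Module.Dual k A) (F : CSym A) :
    leftDeriv (φ + ψ) F = leftDeriv φ F + leftDeriv ψ F := by
  simpa using leftDeriv_linear 1 φ ψ F

lemma leftDeriv_smul (r : k) (φ : Module.Dual k A) (F : CSym A) :
    leftDeriv (r • φ) F = r • leftDeriv φ F := by
  have h0 : leftDeriv (0 : Module.Dual k A) F = 0 := by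
    simpa using leftDeriv_add (0 : Module.Dual k A) 0 F
  simpa [h0] using leftDeriv_linear r φ 0 F

lemma leftDeriv_gen (φ : Module.Dual k A) (y : A) : leftDeriv φ (gen A y) = φ y • 1 := by
  refine ext_coeff fun p => ?_
  rw [coeff_leftDeriv, coeff_smul, coeff_one, coeff_gen]
  rcases p with _ | p
  · simp [GSym.leftDeriv_ι, Algebra.algebraMap_eq_smul_one]
  · simp

lemma leftDeriv_coeff_zero (φ : Module.Dual k A) (F : CSym A) :
    GSym.leftDeriv A φ (coeff 0 F) = 0 := by
  have hF := coeff_mem_pow 0 F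
  rw [GSym.pow, pow_zero, Submodule.mem_one] at hF
  obtain ⟨r, hr⟩ := hF
  rw [← hr, GSym.leftDeriv_algebraMap]

lemma leftDeriv_mul {d : ℤ} {φ : Module.Dual k A} (hφ : φ ∈ A.dual.gr d) {m : ℤ} {F : CSym A}
    (hF : IsHomog m F) (H : CSym A) :
    leftDeriv φ (F * H) = leftDeriv φ F * H + ksign k (d * m) • (F * leftDeriv φ H) := by
  refine ext_coeff fun p => ?_
  simp only [coeff_leftDeriv, coeff_add, coeff_smul, coeff_mul, map_sum,
    GSym.leftDeriv_mul hφ (hF _), Finset.sum_add_distrib, ← Finset.smul_sum]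
  rw [Finset.Nat.sum_antidiagonal_succ, leftDeriv_coeff_zero, zero_mul, zero_add,
    Finset.Nat.sum_antidiagonal_succ' (f := fun q => coeff q.1 F * _), leftDeriv_coeff_zero,
    mul_zero, zero_add]

namespace IsHomog

variable {d m : ℤ} {F : CSym A}

lemma map (hF : IsHomog m F) (f : GrHom A B) : IsHomog m (CSym.map f F) :=
  fun p => by rw [coeff_map]; exact GSym.map_mem_homog f (hF p)

lemma leftDeriv {φ : Module.Dual k A} (hφ : φ ∈ A.dual.gr d) (hF : IsHomog m F) :
    IsHomog (m + d) (leftDeriv φ F) :=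
  fun p => by rw [coeff_leftDeriv]; exact GSym.leftDeriv_mem_homog hφ (hF _)

lemma rightDeriv {φ : Module.Dual k A} (hφ : φ ∈ A.dual.gr d) (hF : IsHomog m F) :
    IsHomog (m + d) (rightDeriv φ F) :=
  fun p => by rw [coeff_rightDeriv]; exact GSym.rightDeriv_mem_homog hφ (hF _)

lemma comm {H : CSym A} (hF : IsHomog m F) (hH : IsHomog d H) :
    F * H = ksign k (m * d) • (H * F) := by
  refine ext_coeff fun p => ?_
  rw [coeff_smul, coeff_mul, coeff_mul, Finset.smul_sum, ← Finset.Nat.sum_antidiagonal_swap]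
  exact Finset.sum_congr rfl fun q _ => GSym.homog_comm (hF _) (hH _)

lemma leftDeriv_eq_rightDeriv {φ : Module.Dual k A} (hφ : φ ∈ A.dual.gr d) (hF : IsHomog m F) :
    CSym.leftDeriv φ F = ksign k (d * (m + 1)) • CSym.rightDeriv φ F := by
  refine ext_coeff fun p => ?_
  rw [coeff_leftDeriv, coeff_smul, coeff_rightDeriv, GSym.leftDeriv_eq_rightDeriv hφ (hF _)]

lemma rightDeriv_eq_leftDeriv {φ : Module.Dual k A} (hφ : φ ∈ A.dual.gr d) (hF : IsHomog m F) :
    CSym.rightDeriv φ F = ksign k (d * (m + 1)) • CSym.leftDeriv φ F := by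
  rw [leftDeriv_eq_rightDeriv hφ hF, smul_smul, ksign_mul_self, one_smul]

lemma rightDeriv_mul_leftDeriv {n : ℤ} {φ ψ : Module.Dual k A} (hφ : φ ∈ A.dual.gr d)
    (hψ : ψ ∈ A.dual.gr (-d - n)) {S T : CSym A} (hS : IsHomog (n + 1) S)
    (hT : IsHomog (n + 1) T) :
    CSym.rightDeriv ψ S * CSym.leftDeriv φ T
      = (-ksign k ((n + 1) * d)) • (CSym.rightDeriv φ T * CSym.leftDeriv ψ S) := by
  rw [rightDeriv_eq_leftDeriv hψ hS, leftDeriv_eq_rightDeriv hφ hT, smul_mul_assoc, mul_smul_comm,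
    comm (leftDeriv hψ hS) (rightDeriv hφ hT), smul_smul, smul_smul, ← ksign_add, ← ksign_add,
    ← neg_one_mul (ksign k _), ← ksign_of_odd (k := k) odd_one, ← ksign_add]
  congr 1
  refine ksign_congr ?_
  simp only [Int.even_add, Int.even_sub, Int.even_mul, Int.not_even_one, even_neg]
  tauto

end IsHomog

/-! ### The Euler vector field -/

/-- The Euler vector field on formal functions, which multiplies the component in `Sym^p` by `p`. -/
def euler : CSym A →ₗ[k] CSym A where
  toFun F := ofCoeff (fun p => (p : k) • coeff p F) fun p =>
    Submodule.smul_mem _ _ (coeff_mem_pow p F)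
  map_add' F H := ext_coeff fun p => by simp only [coeff_ofCoeff, coeff_add, smul_add]
  map_smul' c F := ext_coeff fun p => by
    simp only [coeff_ofCoeff, coeff_smul, RingHom.id_apply, smul_comm c]

lemma coeff_euler (p : ℕ) (F : CSym A) : coeff p (euler F) = (p : k) • coeff p F :=
  coeff_ofCoeff _ (fun p => Submodule.smul_mem _ _ (coeff_mem_pow p F)) _

lemma IsHomog.euler {d : ℤ} {F : CSym A} (hF : IsHomog d F) : IsHomog d (euler F) :=
  fun p => by rw [coeff_euler]; exact Submodule.smul_mem _ _ (hF p)

lemma euler_mul (F H : CSym A) : euler (F * H) = euler F * H + F * euler H := by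
  refine ext_coeff fun p => ?_
  rw [coeff_euler, coeff_add, coeff_mul, coeff_mul, coeff_mul, Finset.smul_sum,
    ← Finset.sum_add_distrib]
  refine Finset.sum_congr rfl fun q hq => ?_
  rw [coeff_euler, coeff_euler, smul_mul_assoc, mul_smul_comm, ← add_smul, ← Nat.cast_add,
    Finset.HasAntidiagonal.mem_antidiagonal.1 hq]

lemma leftDeriv_euler (φ : Module.Dual k A) (F : CSym A) :
    leftDeriv φ (euler F) = euler (leftDeriv φ F) + leftDeriv φ F := by
  refine ext_coeff fun p => ?_
  simp only [coeff_leftDeriv, coeff_euler, coeff_add, Nat.cast_succ, add_smul, one_smul, map_add,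
    map_smul]

lemma rightDeriv_euler (φ : Module.Dual k A) (F : CSym A) :
    rightDeriv φ (euler F) = euler (rightDeriv φ F) + rightDeriv φ F := by
  refine ext_coeff fun p => ?_
  simp only [coeff_rightDeriv, coeff_euler, coeff_add, Nat.cast_succ, add_smul, one_smul, map_add,
    map_smul]

lemma eq_zero_of_euler_eq_zero [CharZero k] {F : CSym A} (h : euler F = 0) (h0 : coeff 0 F = 0) :
    F = 0 := by
  refine ext_coeff fun p => ?_
  rcases p with _ | p
  · exact h0
  · have hp := congrArg (coeff (p + 1)) h
    rw [coeff_euler, coeff_zero] at hp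
    exact (smul_eq_zero.1 hp).resolve_left (Nat.cast_ne_zero.2 p.succ_ne_zero)

lemma euler_eq_sum {κ : Type*} [Fintype κ] {φ : κ → Module.Dual k A} {y : κ → A}
    (h : ∀ z, ∑ i, φ i z • y i = z) (F : CSym A) :
    euler F = ∑ i, rightDeriv (φ i) F * gen A (y i) := by
  refine ext_coeff fun p => ?_
  rw [coeff_euler, coeff_sum]
  rcases p with _ | p
  · simp [coeff_zero_mul_gen]
  · simp only [coeff_succ_mul_gen, coeff_rightDeriv]
    exact (GSym.sum_rightDeriv_mul_ι_of_mem_pow h (coeff_mem_pow _ F)).symm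

end CSym

namespace VectorField

variable {k : Type u} [Field k] {G : GrSpace.{u, v} k} (Q : VectorField G)

/-! ### Vector fields -/

lemma act_eq_sum (F : Fun G) {κ : Type*} [Fintype κ] (ξ : κ → Module.Dual k G) (y : κ → G)
    (h : ∀ z, ∑ j, ξ j z • y j = z) : Q.act F = ∑ j, Q (ξ j) * dirDeriv (y j) F :=
  (sum_apply_apply_eq_of_sum_smul_eq ξ y _ _ (fun z => by simp [h])
    (LinearMap.mk₂ k (fun (ξ : Module.Dual k G) (y : G) => Q ξ * dirDeriv y F)
      (fun ξ η y => by rw [map_add, add_mul])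
      (fun c ξ y => by rw [map_smul, smul_mul_assoc])
      (fun ξ y z => by rw [dirDeriv, dirDeriv, dirDeriv, map_add, CSym.leftDeriv_add, mul_add])
      (fun c ξ y => by rw [dirDeriv, dirDeriv, map_smul, CSym.leftDeriv_smul,
        mul_smul_comm]))).symm

lemma act_eq_sum_basis (F : Fun G) {κ : Type*} [Fintype κ] (b : Module.Basis κ k G) :
    Q.act F = ∑ j, Q (b.coord j) * dirDeriv (b j) F :=
  Q.act_eq_sum F _ _ fun z => by simp

lemma act_sum {κ : Type*} (s : Finset κ) (F : κ → Fun G) :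
    Q.act (∑ i ∈ s, F i) = ∑ i ∈ s, Q.act (F i) := by
  simp only [act, map_sum, Finset.mul_sum]
  exact Finset.sum_comm

lemma act_gen (ξ : Module.Dual k G) : Q.act (CSym.gen (G.shift 1).dual ξ) = Q ξ := by
  have hgen (y : G) : dirDeriv y (CSym.gen (G.shift 1).dual ξ) = ξ y • (1 : Fun G) :=
    CSym.leftDeriv_gen _ _
  simp only [act, hgen, mul_smul_comm, mul_one, ← map_smul, ← map_sum]
  congr 1
  exact (Module.finBasis k G).ext fun j => by simp

lemma act_mul {Q : VectorField G} {m : ℤ} (hQ : Q.IsHomog m) {d : ℤ} {F : Fun G}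
    (hF : CSym.IsHomog d F) (H : Fun G) :
    Q.act (F * H) = Q.act F * H + ksign k (m * d) • (F * Q.act H) := by
  obtain ⟨r, b, e, hb⟩ := G.exists_homogeneous_basis_shift 1
  have hterm (i : Fin r) : Q (b.coord i) * dirDeriv (b i) (F * H)
      = Q (b.coord i) * dirDeriv (b i) F * H
        + ksign k (m * d) • (F * (Q (b.coord i) * dirDeriv (b i) H)) := by
    have hcomm := (hQ _ _ (coord_mem_gr (A := G.shift 1) b hb i)).comm hF
    have hderiv : dirDeriv (b i) (F * H)
        = dirDeriv (b i) F * H + ksign k (e i * d) • (F * dirDeriv (b i) H) :=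
      CSym.leftDeriv_mul (eval_mem_gr (A := G.shift 1) (hb i)) hF H
    rw [hderiv, mul_add, mul_smul_comm, ← mul_assoc, ← mul_assoc, hcomm, smul_mul_assoc, smul_smul,
      ← ksign_add, mul_assoc F]
    congr 2
    exact ksign_congr ⟨0, by ring⟩
  simp only [Q.act_eq_sum_basis _ b, hterm, Finset.sum_add_distrib, Finset.sum_mul, Finset.mul_sum,
    Finset.smul_sum]

end VectorField

namespace ShiftedSymplectic

variable {k : Type u} [Field k] {G : GrSpace.{u, v} k} {n : ℤ} (ω : ShiftedSymplectic G n)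

/-! ### The Poisson bracket -/

lemma sgn_one_sgn_one (y : G) : G.sgn 1 (G.sgn 1 y) = y := by
  have h : G.sgn 1 ∘ₗ G.sgn 1 = LinearMap.id := G.linearMap_ext fun d b hb => by
    simp [sgn, diag_of_mem G _ hb, smul_smul, ksign_mul_self]
  exact LinearMap.congr_fun h y

lemma shifted_of_mem {d : ℤ} {y : G} (hy : y ∈ G.gr d) (z : G) :
    ω.shifted y z = ksign k d * ω.form y z := by
  simp [shifted, sgn, diag_of_mem G _ hy]

/-- The form on `𝔤[1]` as a map of degree `n` to the dual. -/
def shiftedHom : GrHom (G.shift 1) ((G.shift 1).dual.shift n) where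
  lin := ω.shifted
  map_gr d y hy e he a ha := by
    have hy' : y ∈ G.gr (d + 1) := hy
    rw [ω.shifted_of_mem hy', ω.degree _ _ _ hy' _ ha (by omega), mul_zero]

lemma shifted_bijective : Function.Bijective ω.shifted :=
  ω.form.bijective.comp (Function.bijective_iff_has_inverse.2
    ⟨G.sgn 1, sgn_one_sgn_one, sgn_one_sgn_one⟩)

lemma hamiltonian_shifted (S : Fun G) (y : G) :
    ω.hamiltonian S (ω.shifted y) = dirDerivRight y S := by
  change dirDerivRight (G.sgn 1 (ω.form.symm (ω.form (G.sgn 1 y)))) S = _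
  rw [LinearEquiv.symm_apply_apply, sgn_one_sgn_one]

lemma shifted_antisymm_of_mem {d e : ℤ} {y z : G} (hy : y ∈ G.gr d) (hz : z ∈ G.gr e) :
    ω.shifted y z = -(ksign k ((n + 1) * (e - 1)) * ω.shifted z y) := by
  rw [ω.shifted_of_mem hy, ω.shifted_of_mem hz, ω.symm d e y hy z hz]
  by_cases h : d + e = 2 - n
  · rw [← mul_assoc, ← mul_assoc, ← neg_mul, ← ksign_add, ← ksign_add,
      ← neg_one_mul (ksign k _), ← ksign_of_odd (k := k) odd_one, ← ksign_add]
    congr 1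
    refine ksign_congr ?_
    obtain rfl : d = 2 - n - e := by omega
    simp only [Int.even_add, Int.even_sub, Int.even_mul, Int.not_even_one, even_two]
    tauto
  · rw [ω.degree e d z hz y hy (by omega)]
    simp

lemma shifted_antisymm (y z : G) :
    ω.shifted y z = -ω.shifted ((G.shift 1).sgn (n + 1) z) y := by
  have h : ω.shifted.flip = -(ω.shifted ∘ₗ (G.shift 1).sgn (n + 1)) :=
    G.linearMap_ext fun e z hz => G.linearMap_ext fun d y hy => by
      have hz' : z ∈ (G.shift 1).gr (e - 1) := by
        change z ∈ G.gr (e - 1 + 1)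
        rwa [sub_add_cancel]
      simp [sgn, diag_of_mem (G.shift 1) _ hz', ω.shifted_antisymm_of_mem hy hz]
  exact LinearMap.congr_fun (LinearMap.congr_fun h z) y

lemma sum_shifted_smul {κ : Type*} [Fintype κ] (b : Module.Basis κ k G) {d : κ → ℤ}
    (hb : ∀ i, b i ∈ (G.shift 1).gr (d i)) {z : κ → G} (hz : ∀ i, ω.shifted (z i) = b.coord i)
    (y : G) : ∑ i, ((-ksign k ((n + 1) * d i)) • ω.shifted (b i)) y • z i = y := by
  classical
  apply ω.shifted_bijective.1
  rw [map_sum]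
  refine b.ext fun j => ?_
  have hj : ω.shifted y (b j) = -ksign k ((n + 1) * d j) * ω.shifted (b j) y := by
    rw [ω.shifted_antisymm, sgn, diag_of_mem (G.shift 1) _ (hb j)]
    simp
  simp [hj, hz, Finsupp.single_apply]

lemma exists_homogeneous_shifted_eq {d : ℤ} {ξ : Module.Dual k G}
    (hξ : ξ ∈ (G.shift 1).dual.gr d) : ∃ z ∈ (G.shift 1).gr (d - n), ω.shifted z = ξ := by
  refine ⟨(ω.shiftedHom.inverse ω.shifted_bijective).lin ξ, GrHom.map_gr _ _ _ ?_,
    (LinearEquiv.ofBijective ω.shifted ω.shifted_bijective).apply_symm_apply ξ⟩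
  change _ ∈ (G.shift 1).dual.gr (d - n + n)
  rwa [sub_add_cancel]

lemma bracket_comm {S T : Fun G} (hS : CSym.IsHomog (n + 1) S) (hT : CSym.IsHomog (n + 1) T) :
    ω.bracket S T = ω.bracket T S := by
  obtain ⟨m, b, d, hb⟩ := G.exists_homogeneous_basis_shift 1
  choose z hzd hz using fun i =>
    ω.exists_homogeneous_shifted_eq (coord_mem_gr (A := G.shift 1) b hb i)
  rw [bracket, bracket, VectorField.act_eq_sum_basis _ T b,
    VectorField.act_eq_sum _ S _ z (ω.sum_shifted_smul b hb hz)]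
  refine Finset.sum_congr rfl fun i _ => ?_
  rw [← hz i, map_smul, hamiltonian_shifted, hamiltonian_shifted, smul_mul_assoc]
  exact CSym.IsHomog.rightDeriv_mul_leftDeriv (eval_mem_gr (A := G.shift 1) (hb i))
    (eval_mem_gr (A := G.shift 1) (hzd i)) hS hT

-- The bracket removes one linear coordinate from each of its arguments.
lemma euler_bracket (S T : Fun G) :
    CSym.euler (ω.bracket S T) + (2 : k) • ω.bracket S T
      = ω.bracket (CSym.euler S) T + ω.bracket S (CSym.euler T) := by
  simp only [bracket, VectorField.act, map_sum, Finset.smul_sum, ← Finset.sum_add_distrib]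
  refine Finset.sum_congr rfl fun i _ => ?_
  have hS (ξ : Module.Dual k G) : ω.hamiltonian (CSym.euler S) ξ
      = CSym.euler (ω.hamiltonian S ξ) + ω.hamiltonian S ξ := CSym.rightDeriv_euler _ S
  have hT (y : G) : dirDeriv y (CSym.euler T) = CSym.euler (dirDeriv y T) + dirDeriv y T :=
    CSym.leftDeriv_euler _ T
  rw [hS, hT, CSym.euler_mul, add_mul, mul_add, two_smul]
  abel

lemma act_hamiltonian_dirDerivRight {S : Fun G} (hQ : (ω.hamiltonian S).IsLInfinity) (y : G) :
    (ω.hamiltonian S).act (dirDerivRight y S) = 0 := by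
  rw [← hamiltonian_shifted, ← VectorField.act_gen]
  exact hQ.square _

lemma bracket_euler_right {S : Fun G} (hS : CSym.IsHomog (n + 1) S)
    (hQ : (ω.hamiltonian S).IsLInfinity) : ω.bracket S (CSym.euler S) = ω.bracket S S := by
  obtain ⟨m, b, d, hb⟩ := G.exists_homogeneous_basis_shift 1
  have hdual (z : Module.Dual k G) : ∑ i, Module.Dual.eval k G (b i) z • b.coord i = z :=
    b.ext fun j => by simp
  have hE : CSym.euler S
      = ∑ i, dirDerivRight (b i) S * CSym.gen (G.shift 1).dual (b.coord i) :=
    CSym.euler_eq_sum (A := (G.shift 1).dual) hdual S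
  rw [hE, bracket, VectorField.act_sum, bracket, VectorField.act_eq_sum_basis _ S b]
  refine Finset.sum_congr rfl fun i _ => ?_
  have hi := eval_mem_gr (A := G.shift 1) (hb i)
  have hright : CSym.IsHomog (n + 1 + d i) (dirDerivRight (b i) S) :=
    CSym.IsHomog.rightDeriv hi hS
  have hleft : dirDeriv (b i) S = ksign k (d i * (n + 1 + 1)) • dirDerivRight (b i) S :=
    CSym.IsHomog.leftDeriv_eq_rightDeriv hi hS
  rw [VectorField.act_mul hQ.degree hright, ω.act_hamiltonian_dirDerivRight hQ, zero_mul, zero_add,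
    VectorField.act_gen, hleft, mul_smul_comm,
    (hQ.degree _ _ (coord_mem_gr (A := G.shift 1) b hb i)).comm hright, smul_smul, ← ksign_add]
  congr 1
  refine ksign_congr ?_
  simp only [Int.even_add, Int.even_sub, Int.even_mul, Int.not_even_one, even_neg]
  tauto

lemma coeff_zero_bracket (S : Fun G) {T : Fun G} (hT : CSym.coeff 1 T = 0) :
    CSym.coeff 0 (ω.bracket S T) = 0 := by
  have hderiv (y : G) : CSym.coeff 0 (dirDeriv y T) = 0 := by
    rw [dirDeriv, CSym.coeff_leftDeriv, hT, map_zero]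
  simp [bracket, VectorField.act, CSym.coeff_sum, CSym.coeff_mul, hderiv]

theorem bracket_self_eq_zero [CharZero k] {S : Fun G} (hS : CSym.IsHomog (n + 1) S)
    (hS₁ : CSym.coeff 1 S = 0) (hQ : (ω.hamiltonian S).IsLInfinity) : ω.bracket S S = 0 := by
  have hE := ω.euler_bracket S S
  rw [← ω.bracket_comm hS hS.euler, ω.bracket_euler_right hS hQ, two_smul] at hE
  exact CSym.eq_zero_of_euler_eq_zero (by simpa using hE) (ω.coeff_zero_bracket S hS₁)

end ShiftedSymplectic

lemma mul_pow_le_of_mul_le {M : Type*} [Monoid M] [Preorder M] [MulLeftMono M] [MulRightMono M]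
    {a b : M} (h : b * a ≤ a * b) (i : ℕ) : b * a ^ i ≤ a ^ i * b := by
  induction i with
  | zero => simp
  | succ i ih =>
    calc b * a ^ (i + 1) = b * a ^ i * a := by rw [pow_succ, mul_assoc]
      _ ≤ a ^ i * b * a := mul_le_mul_left ih _
      _ = a ^ i * (b * a) := mul_assoc _ _ _
      _ ≤ a ^ i * (a * b) := mul_le_mul_right h _
      _ = a ^ (i + 1) * b := by rw [pow_succ, mul_assoc]

namespace GSym

variable {k : Type u} [Field k] {A : GrSpace.{u, v} k} {B : GrSpace.{u, w} k}

/-! ### Weights in the symmetric algebra of a direct sum -/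

variable (A B) in
/-- The generators of `Sym(A ⊕ B)` coming from `A`; they have weight `0`. -/
def gensLeft : Submodule k (GSym (A.prod B)) :=
  LinearMap.range (ι (A.prod B) ∘ₗ LinearMap.inl k A B)

variable (A B) in
/-- The generators of `Sym(A ⊕ B)` coming from `B`; they have weight `1`. -/
def gensRight : Submodule k (GSym (A.prod B)) :=
  LinearMap.range (ι (A.prod B) ∘ₗ LinearMap.inr k A B)

lemma ι_inl_add_ι_inr (y : A.prod B) :
    ι (A.prod B) (y.1, 0) + ι (A.prod B) (0, y.2) = ι (A.prod B) y := by
  rw [← map_add]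
  simp

lemma weightHom_ι (y : A.prod B) : weightHom A B (ι (A.prod B) y)
    = Polynomial.C (ι (A.prod B) (y.1, 0)) + Polynomial.X * Polynomial.C (ι (A.prod B) (0, y.2)) :=
  lift_ι _ _ y

lemma weightPart_apply (j : ℕ) (a : GSym (A.prod B)) :
    weightPart A B j a = (weightHom A B a).coeff j := rfl

lemma weightPart_algebraMap (j : ℕ) (r : k) : weightPart A B j (algebraMap k _ r)
    = if j = 0 then algebraMap k _ r else 0 := by
  rw [weightPart_apply, AlgHom.commutes, Polynomial.algebraMap_apply, Polynomial.coeff_C]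

lemma weightPart_zero_ι_mul (y : A.prod B) (b : GSym (A.prod B)) :
    weightPart A B 0 (ι (A.prod B) y * b) = ι (A.prod B) (y.1, 0) * weightPart A B 0 b := by
  simp [weightPart_apply, weightHom_ι y]

lemma weightPart_succ_ι_mul (j : ℕ) (y : A.prod B) (b : GSym (A.prod B)) :
    weightPart A B (j + 1) (ι (A.prod B) y * b) = ι (A.prod B) (y.1, 0) * weightPart A B (j + 1) b
      + ι (A.prod B) (0, y.2) * weightPart A B j b := by
  simp [weightPart_apply, weightHom_ι y, add_mul, mul_assoc]

lemma weightPart_zero_mul_ι (b : GSym (A.prod B)) (y : A.prod B) :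
    weightPart A B 0 (b * ι (A.prod B) y) = weightPart A B 0 b * ι (A.prod B) (y.1, 0) := by
  simp [weightPart_apply, weightHom_ι y]

lemma weightPart_succ_mul_ι (j : ℕ) (b : GSym (A.prod B)) (y : A.prod B) :
    weightPart A B (j + 1) (b * ι (A.prod B) y) = weightPart A B (j + 1) b * ι (A.prod B) (y.1, 0)
      + weightPart A B j b * ι (A.prod B) (0, y.2) := by
  simp [weightPart_apply, weightHom_ι y, mul_add, ← mul_assoc]

lemma weightPart_zero_mul_ι_inr (b : GSym (A.prod B)) (y : B) :
    weightPart A B 0 (b * ι (A.prod B) (0, y)) = 0 := by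
  rw [weightPart_zero_mul_ι, show ι (A.prod B) (0, 0) = 0 from map_zero _, mul_zero]

lemma weightPart_succ_mul_ι_inr (j : ℕ) (b : GSym (A.prod B)) (y : B) :
    weightPart A B (j + 1) (b * ι (A.prod B) (0, y))
      = weightPart A B j b * ι (A.prod B) (0, y) := by
  rw [weightPart_succ_mul_ι, show ι (A.prod B) (0, 0) = 0 from map_zero _, mul_zero, zero_add]

lemma weightPart_zero (a : GSym (A.prod B)) :
    weightPart A B 0 a = map (GrHom.inl A B) (map (GrHom.fst A B) a) := by
  induction a using GSym.induction with
  | hc r => rw [weightPart_algebraMap, if_pos rfl, AlgHom.commutes, AlgHom.commutes]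
  | hι y =>
    rw [map_ι, map_ι, weightPart_apply, weightHom_ι]
    simp
  | hm b c hb hc =>
    rw [weightPart_apply, map_mul, Polynomial.mul_coeff_zero, ← weightPart_apply,
      ← weightPart_apply, hb, hc, map_mul, map_mul]
  | ha b c hb hc => simp only [map_add, hb, hc]

lemma weightPart_mem_homog (j : ℕ) {d : ℤ} {a : GSym (A.prod B)} (ha : a ∈ homog (A.prod B) d) :
    weightPart A B j a ∈ homog (A.prod B) d := by
  induction ha using homog_induction generalizing j with
  | one =>
    rw [← map_one (algebraMap k _), weightPart_algebraMap]
    split_ifs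
    · exact algebraMap_mem_homog 1
    · exact zero_mem _
  | ι_mul e m y hy b _ ih =>
    have hleft : (y.1, (0 : B)) ∈ (A.prod B).gr e := ⟨hy.1, zero_mem _⟩
    have hright : ((0 : A), y.2) ∈ (A.prod B).gr e := ⟨zero_mem _, hy.2⟩
    rcases j with _ | j
    · rw [weightPart_zero_ι_mul]
      exact ι_mul_mem_homog hleft (ih 0)
    · rw [weightPart_succ_ι_mul]
      exact add_mem (ι_mul_mem_homog hleft (ih _)) (ι_mul_mem_homog hright (ih _))
  | zero => simp
  | add _ _ _ _ _ ha hb => rw [map_add]; exact add_mem (ha j) (hb j)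
  | smul _ _ _ _ ha => rw [map_smul]; exact Submodule.smul_mem _ _ (ha j)

lemma weightPart_eq_zero {p j : ℕ} (hj : p < j) {a : GSym (A.prod B)}
    (ha : a ∈ pow (A.prod B) p) : weightPart A B j a = 0 := by
  unfold pow at ha
  induction ha using Submodule.pow_induction_on_left' generalizing j with
  | algebraMap r => rw [weightPart_algebraMap, if_neg (by omega)]
  | add b c p _ _ ihb ihc => rw [map_add, ihb hj, ihc hj, add_zero]
  | mem_mul m hm p b _ ih =>
    obtain ⟨y, rfl⟩ := hm
    obtain ⟨j, rfl⟩ := Nat.exists_eq_add_one_of_ne_zero (Nat.ne_zero_of_lt hj)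
    rw [weightPart_succ_ι_mul, ih (by omega), ih (by omega), mul_zero, mul_zero, add_zero]

lemma sum_weightPart {p : ℕ} {a : GSym (A.prod B)} (ha : a ∈ pow (A.prod B) p) :
    ∑ j ∈ Finset.range (p + 1), weightPart A B j a = a := by
  unfold pow at ha
  induction ha using Submodule.pow_induction_on_left' with
  | algebraMap r => simp [weightPart_algebraMap]
  | add b c p _ _ ihb ihc => simp only [map_add, Finset.sum_add_distrib, ihb, ihc]
  | mem_mul m hm p b hb ih =>
    obtain ⟨y, rfl⟩ := hm
    have hextend : ∑ j ∈ Finset.range (p + 2), weightPart A B j b = b := by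
      rw [Finset.sum_range_succ, ih, weightPart_eq_zero (Nat.lt_succ_self p) hb, add_zero]
    calc ∑ j ∈ Finset.range (p + 2), weightPart A B j (ι (A.prod B) y * b)
        = ι (A.prod B) (y.1, 0) * ∑ j ∈ Finset.range (p + 2), weightPart A B j b
          + ι (A.prod B) (0, y.2) * ∑ j ∈ Finset.range (p + 1), weightPart A B j b := by
          rw [Finset.sum_range_succ', weightPart_zero_ι_mul,
            Finset.sum_range_succ' (fun j => weightPart A B j b)]
          simp only [weightPart_succ_ι_mul _ y, Finset.sum_add_distrib, mul_add, Finset.mul_sum]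
          abel
      _ = ι (A.prod B) y * b := by rw [hextend, ih, ← add_mul, ι_inl_add_ι_inr]

lemma gensRight_mul_gensLeft_le : gensRight A B * gensLeft A B ≤ gensLeft A B * gensRight A B := by
  rw [Submodule.mul_le]
  rintro _ ⟨b, rfl⟩ _ ⟨a, rfl⟩
  induction b using B.induction_gr with
  | hm d b hb =>
    induction a using A.induction_gr with
    | hm e a ha =>
      have hcomm := ι_comm (A.prod B) (a := ((0 : A), b)) (b := (a, (0 : B)))
        ⟨zero_mem (A.gr d), hb⟩ ⟨ha, zero_mem (B.gr e)⟩
      change ι (A.prod B) (0, b) * ι (A.prod B) (a, 0) ∈ _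
      rw [hcomm]
      exact Submodule.smul_mem _ _ (Submodule.mul_mem_mul ⟨a, rfl⟩ ⟨b, rfl⟩)
    | h0 => rw [map_zero, mul_zero]; exact zero_mem _
    | ha a a' h h' => rw [map_add, mul_add]; exact add_mem h h'
  | h0 => rw [map_zero, zero_mul]; exact zero_mem _
  | ha b b' h h' => rw [map_add, add_mul]; exact add_mem h h'

lemma weightPart_mem {p j : ℕ} (hj : j ≤ p) {a : GSym (A.prod B)} (ha : a ∈ pow (A.prod B) p) :
    weightPart A B j a ∈ gensLeft A B ^ (p - j) * gensRight A B ^ j := by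
  have hleft (y : A.prod B) : ι (A.prod B) (y.1, 0) ∈ gensLeft A B := ⟨y.1, rfl⟩
  have hright (y : A.prod B) : ι (A.prod B) (0, y.2) ∈ gensRight A B := ⟨y.2, rfl⟩
  unfold pow at ha
  induction ha using Submodule.pow_induction_on_left' generalizing j with
  | algebraMap r =>
    obtain rfl := Nat.le_zero.1 hj
    simp [weightPart_algebraMap]
  | add b c p _ _ ihb ihc => rw [map_add]; exact add_mem (ihb hj) (ihc hj)
  | mem_mul m hm p b hb ih =>
    obtain ⟨y, rfl⟩ := hm
    rcases j with _ | j
    · rw [weightPart_zero_ι_mul, Nat.sub_zero, pow_succ', mul_assoc]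
      exact Submodule.mul_mem_mul (hleft y) (by simpa only [Nat.sub_zero] using ih p.zero_le)
    rw [weightPart_succ_ι_mul, Nat.succ_sub_succ]
    refine add_mem ?_ ?_
    · rcases Nat.lt_or_ge p (j + 1) with h | h
      · rw [weightPart_eq_zero h hb, mul_zero]; exact zero_mem _
      · rw [show p - j = p - (j + 1) + 1 by omega, pow_succ', mul_assoc]
        exact Submodule.mul_mem_mul (hleft y) (ih h)
    · have hle : gensRight A B * (gensLeft A B ^ (p - j) * gensRight A B ^ j)
          ≤ gensLeft A B ^ (p - j) * gensRight A B ^ (j + 1) := by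
        rw [← mul_assoc, pow_succ', ← mul_assoc]
        exact mul_le_mul_left (mul_pow_le_of_mul_le gensRight_mul_gensLeft_le _) _
      exact hle (Submodule.mul_mem_mul (hright y) (ih (by omega)))

-- Euler's identity in the fibre coordinates.
lemma weightPart_sum_rightDeriv_mul_ι {κ : Type*} [Fintype κ] {ξ : κ → Module.Dual k B} {y : κ → B}
    (h : ∀ z, ∑ i, ξ i z • y i = z) (j : ℕ) {p : ℕ} {a : GSym (A.prod B)}
    (ha : a ∈ pow (A.prod B) p) :
    weightPart A B j
        (∑ i, rightDeriv (A.prod B) (ξ i ∘ₗ LinearMap.snd k A B) a * ι (A.prod B) (0, y i))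
      = (j : k) • weightPart A B j a := by
  have hproj (z : A.prod B) : ∑ i, (ξ i ∘ₗ LinearMap.snd k A B) z • ((0 : A), y i)
      = ((GrHom.inr A B).comp (GrHom.snd A B)).lin z := by
    refine Prod.ext (by simp [Prod.fst_sum]) ?_
    simpa [Prod.snd_sum] using h z.2
  unfold pow at ha
  induction ha using Submodule.pow_induction_on_right' generalizing j with
  | algebraMap r =>
    rcases j with _ | j <;> simp [rightDeriv_algebraMap, weightPart_algebraMap]
  | add b c _ _ _ ihb ihc =>
    simp only [map_add, add_mul, Finset.sum_add_distrib, ihb, ihc, smul_add]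
  | mul_mem _ b _ ih m hm =>
    obtain ⟨z, rfl⟩ := hm
    have hz : ((GrHom.inr A B).comp (GrHom.snd A B)).lin z = (0, z.2) := rfl
    rw [sum_rightDeriv_mul_ι ((GrHom.inr A B).comp (GrHom.snd A B)) hproj, hz, map_add]
    rcases j with _ | j
    · rw [weightPart_zero_mul_ι_inr, weightPart_zero_mul_ι, ih]
      simp
    · rw [weightPart_succ_mul_ι_inr, weightPart_succ_mul_ι, weightPart_succ_mul_ι, ih, ih]
      simp only [Nat.cast_succ, add_smul, one_smul, smul_add, add_mul, smul_mul_assoc]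
      abel

lemma weightPart_one {κ : Type*} [Fintype κ] {ξ : κ → Module.Dual k B} {y : κ → B}
    (h : ∀ z, ∑ i, ξ i z • y i = z) {p : ℕ} {a : GSym (A.prod B)} (ha : a ∈ pow (A.prod B) p) :
    weightPart A B 1 a = ∑ i, weightPart A B 0
      (rightDeriv (A.prod B) (ξ i ∘ₗ LinearMap.snd k A B) a) * ι (A.prod B) (0, y i) := by
  have hEuler := weightPart_sum_rightDeriv_mul_ι h 1 ha
  rw [Nat.cast_one, one_smul, map_sum] at hEuler
  rw [← hEuler]
  exact Finset.sum_congr rfl fun i _ => weightPart_succ_mul_ι_inr 0 _ _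

end GSym

namespace PolyVec

variable {k : Type u} [Field k] {n : ℤ} {L : GrSpace.{u, v} k}

/-! ### Components of polyvector fields -/

lemma coeff_component (j p : ℕ) (P : PolyVec n L) : CSym.coeff p (component j P)
    = GSym.weightPart (L.shift 1).dual (L.shift (1 - n)) j (CSym.coeff p P) :=
  CSym.coeff_extend _ _ _ _ _

lemma isPolyDegree_component (j : ℕ) (P : PolyVec n L) : IsPolyDegree j (component j P) := by
  intro p
  rw [coeff_component]
  rcases Nat.lt_or_ge p j with h | h
  · rw [GSym.weightPart_eq_zero h (CSym.coeff_mem_pow p P)]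
    exact zero_mem _
  · exact Submodule.mem_iSup_of_mem (p - j) (Submodule.mem_iSup_of_mem (Nat.sub_add_cancel h)
      (GSym.weightPart_mem h (CSym.coeff_mem_pow p P)))

lemma isHomog_component {d : ℤ} {P : PolyVec n L} (hP : CSym.IsHomog d P) (j : ℕ) :
    CSym.IsHomog d (component j P) := fun p => by
  rw [coeff_component]
  exact GSym.weightPart_mem_homog j (hP p)

/-- The restriction of a polyvector field to the zero section of `T_L[-n]`, that is, its value at
`θ = 0`. -/
def restrict (n : ℤ) (L : GrSpace.{u, v} k) : PolyVec n L →ₗ[k] Fun L :=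
  CSym.map (GrHom.fst (L.shift 1).dual (L.shift (1 - n)))

lemma component_zero (P : PolyVec n L) : component 0 P = ofFun n L (restrict n L P) := by
  refine CSym.ext_coeff fun p => ?_
  rw [coeff_component, ofFun, restrict, CSym.coeff_map, CSym.coeff_map, GSym.weightPart_zero]

lemma component_one (P : PolyVec n L) :
    component 1 P = ∑ i, ofFun n L (restrict n L
      (CSym.rightDeriv (fibreDual n ((Module.finBasis k L).coord i)) P)) *
        θ n L (Module.finBasis k L i) := by
  have hbasis (z : L) : ∑ i, (Module.finBasis k L).coord i z • Module.finBasis k L i = z :=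
    (Module.finBasis k L).sum_repr z
  refine CSym.ext_coeff fun p => ?_
  simp only [coeff_component, CSym.coeff_sum, θ, ← component_zero]
  rcases p with _ | p
  · simp [CSym.coeff_zero_mul_gen,
      GSym.weightPart_eq_zero Nat.zero_lt_one (CSym.coeff_mem_pow 0 P)]
  · rw [GSym.weightPart_one (A := (L.shift 1).dual) (B := L.shift (1 - n)) hbasis
      (CSym.coeff_mem_pow (p + 1) P)]
    refine Finset.sum_congr rfl fun i _ => ?_
    rw [CSym.coeff_succ_mul_gen, coeff_component, CSym.coeff_rightDeriv, fibreDual]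

lemma eq_components_add_tower (P : PolyVec n L) :
    P = component 0 P + component 1 P + tower (fun j => component j P) := by
  refine CSym.ext_coeff fun p => ?_
  have hp := CSym.coeff_mem_pow p P
  simp only [CSym.coeff_add, tower, CSym.coeff_ofCoeff, coeff_component]
  conv_lhs => rw [← GSym.sum_weightPart hp]
  rcases p with _ | p
  · rw [GSym.weightPart_eq_zero Nat.zero_lt_one hp]
    simp
  · rw [Finset.range_eq_Ico, Finset.sum_eq_sum_Ico_succ_bot (by omega),
      Finset.sum_eq_sum_Ico_succ_bot (by omega), ← add_assoc]
    rfl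

end PolyVec

namespace IsStrictMap

variable {k : Type u} [Field k] {G : GrSpace.{u, v} k} {L : GrSpace.{u, w} k}

/-! ### Lagrangian splittings -/

lemma pullback_apply {f : GrHom L G} {Q' : VectorField L} {Q : VectorField G}
    (h : IsStrictMap f Q' Q) (ξ : Module.Dual k G) : pullback f (Q ξ) = Q' (ξ ∘ₗ f.lin) := by
  rw [← Q.act_gen, h, pullback, CSym.map_gen]
  exact Q'.act_gen (ξ ∘ₗ f.lin)

end IsStrictMap

namespace LagrangianSplitting

variable {k : Type u} [Field k] {G : GrSpace.{u, v} k} {n : ℤ} {ω : ShiftedSymplectic G n}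
  {Lp : GrSpace.{u, w} k} {Lm : GrSpace.{u, x} k} (D : LagrangianSplitting ω Lp Lm)

lemma split_f (a : Lp) : D.split.lin (D.f.lin a) = (a, 0) := by simpa using D.split_sumHom a 0

lemma split_g (b : Lm) : D.split.lin (D.g.lin b) = (0, b) := by simpa using D.split_sumHom 0 b

lemma f_add_g_split (y : G) : D.f.lin (D.split.lin y).1 + D.g.lin (D.split.lin y).2 = y :=
  (LinearEquiv.ofBijective D.sumHom.lin D.sumHom_bijective).apply_symm_apply y

lemma shifted_f_f (a b : Lp) : ω.shifted (D.f.lin a) (D.f.lin b) = 0 :=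
  shifted_isotropic ω D.f D.f_isotropic a b

lemma shifted_g_g (a b : Lm) : ω.shifted (D.g.lin a) (D.g.lin b) = 0 :=
  shifted_isotropic ω D.g D.g_isotropic a b

/-- The pairing `b ↦ Ω(b, ·)` identifying `𝔩₋` with the dual of `𝔩₊`, up to shifts. -/
def pairing : Lm →ₗ[k] Module.Dual k Lp := D.f.lin.dualMap ∘ₗ ω.shifted ∘ₗ D.g.lin

lemma pairing_apply (b : Lm) (a : Lp) : D.pairing b a = ω.shifted (D.g.lin b) (D.f.lin a) := rfl

lemma shifted_g (b : Lm) (y : G) : ω.shifted (D.g.lin b) y = D.pairing b (D.split.lin y).1 := by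
  conv_lhs => rw [← D.f_add_g_split y]
  rw [map_add, shifted_g_g, add_zero, pairing_apply]

lemma shifted_f (y : G) (a : Lp) : ω.shifted y (D.f.lin a) = D.pairing (D.split.lin y).2 a := by
  conv_lhs => rw [← D.f_add_g_split y]
  rw [map_add, LinearMap.add_apply, shifted_f_f, zero_add, pairing_apply]

lemma pairing_injective : Function.Injective D.pairing := by
  rw [injective_iff_map_eq_zero]
  intro b hb
  refine D.g_injective (ω.shifted_bijective.1 (LinearMap.ext fun y => ?_))
  rw [shifted_g, hb, map_zero, map_zero, LinearMap.zero_apply, LinearMap.zero_apply]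

lemma pairing_flip_injective : Function.Injective D.pairing.flip := by
  rw [injective_iff_map_eq_zero]
  intro a ha
  refine D.f_injective ((shifted_left_injective ω _ fun y => ?_).trans (map_zero _).symm)
  rw [shifted_f, ← LinearMap.flip_apply, ha, LinearMap.zero_apply]

lemma pairing_surjective : Function.Surjective D.pairing :=
  have := LinearMap.IsPerfPair.of_injective D.pairing_injective D.pairing_flip_injective
  (LinearMap.IsPerfPair.bijective_left D.pairing).2

lemma shifted_f_sgn (a : Lp) (z : G) :
    ω.shifted (D.f.lin ((Lp.shift 1).sgn (n + 1) a)) z = -D.pairing (D.split.lin z).2 a := by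
  have hf : D.f.lin ((Lp.shift 1).sgn (n + 1) a) = (G.shift 1).sgn (n + 1) (D.f.lin a) :=
    LinearMap.congr_fun (map_diag (D.f.shift 1) _) a
  rw [hf, ← shifted_f, ω.shifted_antisymm z, neg_neg]

lemma sum_pairing_smul_f {κ : Type*} [Fintype κ] (e : Module.Basis κ k Lp) {b : κ → Lm}
    (hb : ∀ i, D.pairing (b i) = e.coord i) (z : G) :
    ∑ i, ω.shifted (D.g.lin (b i)) z • D.f.lin (e i) = D.f.lin (D.split.lin z).1 := by
  simp only [shifted_g, hb, ← map_smul, ← map_sum]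
  congr 1
  simp

lemma sum_pairing_smul_g {κ : Type*} [Fintype κ] (e : Module.Basis κ k Lp) {b : κ → Lm}
    (hb : ∀ i, D.pairing (b i) = e.coord i) (z : G) :
    ∑ i, ((-1 : k) • ω.shifted (D.f.lin ((Lp.shift 1).sgn (n + 1) (e i)))) z • D.g.lin (b i)
      = D.g.lin (D.split.lin z).2 := by
  classical
  simp only [← map_smul, ← map_sum]
  congr 1
  refine D.pairing_injective (e.ext fun j => ?_)
  simp [hb, D.shifted_f_sgn (e j) z, Finsupp.single_apply]

theorem bracket_eq_sum {κ : Type*} [Fintype κ] (e : Module.Basis κ k Lp) {b : κ → Lm}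
    (hb : ∀ i, D.pairing (b i) = e.coord i) (S T : Fun G) :
    ω.bracket S T = ∑ i, (dirDerivRight (D.g.lin (b i)) S * dirDeriv (D.f.lin (e i)) T -
      dirDerivRight (D.f.lin ((Lp.shift 1).sgn (n + 1) (e i))) S * dirDeriv (D.g.lin (b i)) T) := by
  rw [ShiftedSymplectic.bracket, VectorField.act_eq_sum _ T
    (Sum.elim (fun i => ω.shifted (D.g.lin (b i)))
      fun i => (-1 : k) • ω.shifted (D.f.lin ((Lp.shift 1).sgn (n + 1) (e i))))
    (Sum.elim (fun i => D.f.lin (e i)) fun i => D.g.lin (b i))]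
  · simp only [Fintype.sum_sum_type, Sum.elim_inl, Sum.elim_inr, map_smul,
      ω.hamiltonian_shifted, smul_mul_assoc, ← Finset.sum_add_distrib, CSym.add_neg_one_smul]
  · intro z
    rw [Fintype.sum_sum_type]
    exact (congrArg₂ (· + ·) (D.sum_pairing_smul_f e hb z) (D.sum_pairing_smul_g e hb z)).trans
      (D.f_add_g_split z)

/-- The linear coordinates on `𝔤` in which `ω` is canonical; `toPolyVec` is the induced map. -/
def coordInv : GrHom (G.shift 1).dual ((Lp.shift 1).dual.prod (Lp.shift (1 - n))) :=
  D.coordHom.inverse D.coordHom_bijective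

lemma coordHom_coordInv (φ : Module.Dual k G) : D.coordHom.lin (D.coordInv.lin φ) = φ :=
  (LinearEquiv.ofBijective D.coordHom.lin D.coordHom_bijective).apply_symm_apply φ

lemma coordInv_coordHom (z : (Lp.shift 1).dual.prod (Lp.shift (1 - n))) :
    D.coordInv.lin (D.coordHom.lin z) = z :=
  (LinearEquiv.ofBijective D.coordHom.lin D.coordHom_bijective).symm_apply_apply z

lemma baseDual_comp_coordInv (a : Lp) :
    PolyVec.baseDual n a ∘ₗ D.coordInv.lin = Module.Dual.eval k G (D.f.lin a) := by
  refine LinearMap.ext fun φ => ?_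
  obtain ⟨⟨ξ, b⟩, rfl⟩ := D.coordHom_bijective.2 φ
  rw [LinearMap.comp_apply, coordInv_coordHom, Module.Dual.eval_apply, coordHom_apply, split_f]
  simp [PolyVec.baseDual]

lemma fibreDual_comp_coordInv (b : Lm) :
    PolyVec.fibreDual n (D.pairing b) ∘ₗ D.coordInv.lin = Module.Dual.eval k G (D.g.lin b) := by
  refine LinearMap.ext fun φ => ?_
  obtain ⟨⟨ξ, a⟩, rfl⟩ := D.coordHom_bijective.2 φ
  rw [LinearMap.comp_apply, coordInv_coordHom, Module.Dual.eval_apply, coordHom_apply, split_g]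
  simp [PolyVec.fibreDual, pairing_apply]

lemma toPolyVec_injective : Function.Injective D.toPolyVec := by
  have hcomp : D.coordHom.comp D.coordInv = GrHom.id (G.shift 1).dual :=
    GrHom.ext (LinearMap.ext D.coordHom_coordInv)
  refine Function.LeftInverse.injective (g := CSym.map D.coordHom) fun F => ?_
  exact (CSym.map_map _ _ F).trans (hcomp ▸ CSym.map_id F)

lemma toPolyVec_mul (F H : Fun G) : D.toPolyVec (F * H) = D.toPolyVec F * D.toPolyVec H :=
  CSym.map_mul D.coordInv F H

lemma rightDeriv_baseDual_toPolyVec (a : Lp) (F : Fun G) :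
    CSym.rightDeriv (PolyVec.baseDual n a) (D.toPolyVec F)
      = D.toPolyVec (dirDerivRight (D.f.lin a) F) := by
  rw [dirDerivRight, ← baseDual_comp_coordInv]
  exact CSym.rightDeriv_map D.coordInv _ F

lemma leftDeriv_baseDual_toPolyVec (a : Lp) (F : Fun G) :
    CSym.leftDeriv (PolyVec.baseDual n a) (D.toPolyVec F)
      = D.toPolyVec (dirDeriv (D.f.lin a) F) := by
  rw [dirDeriv, ← baseDual_comp_coordInv]
  exact CSym.leftDeriv_map D.coordInv _ F

lemma rightDeriv_fibreDual_toPolyVec (b : Lm) (F : Fun G) :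
    CSym.rightDeriv (PolyVec.fibreDual n (D.pairing b)) (D.toPolyVec F)
      = D.toPolyVec (dirDerivRight (D.g.lin b) F) := by
  rw [dirDerivRight, ← fibreDual_comp_coordInv]
  exact CSym.rightDeriv_map D.coordInv _ F

lemma leftDeriv_fibreDual_toPolyVec (b : Lm) (F : Fun G) :
    CSym.leftDeriv (PolyVec.fibreDual n (D.pairing b)) (D.toPolyVec F)
      = D.toPolyVec (dirDeriv (D.g.lin b) F) := by
  rw [dirDeriv, ← fibreDual_comp_coordInv]
  exact CSym.leftDeriv_map D.coordInv _ F

theorem toPolyVec_bracket (S T : Fun G) :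
    D.toPolyVec (ω.bracket S T) = PolyVec.schouten (D.toPolyVec S) (D.toPolyVec T) := by
  choose b hb using fun i => D.pairing_surjective ((Module.finBasis k Lp).coord i)
  simp only [D.bracket_eq_sum (Module.finBasis k Lp) hb, PolyVec.schouten, map_sum, ← hb,
    rightDeriv_baseDual_toPolyVec, leftDeriv_baseDual_toPolyVec, rightDeriv_fibreDual_toPolyVec,
    leftDeriv_fibreDual_toPolyVec, ← toPolyVec_mul]
  exact Finset.sum_congr rfl fun i _ => map_sub D.toPolyVec _ _

lemma schouten_toPolyVec_self_eq_zero_iff (T : Fun G) :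
    PolyVec.schouten (D.toPolyVec T) (D.toPolyVec T) = 0 ↔ ω.bracket T T = 0 := by
  rw [← toPolyVec_bracket, map_eq_zero_iff _ D.toPolyVec_injective]

lemma restrict_toPolyVec (F : Fun G) :
    PolyVec.restrict n Lp (D.toPolyVec F) = pullback D.f F := by
  have hcomp : (GrHom.fst (Lp.shift 1).dual (Lp.shift (1 - n))).comp D.coordInv
      = (D.f.shift 1).dual := by
    refine GrHom.ext (LinearMap.ext fun φ => LinearMap.ext fun c => ?_)
    exact LinearMap.congr_fun (D.baseDual_comp_coordInv c) φ
  exact (CSym.map_map _ _ F).trans (hcomp ▸ rfl)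

lemma dirDerivRight_pullback_eq_zero {S : Fun G} {Qp : VectorField Lp}
    (hf : IsStrictMap D.f Qp (ω.hamiltonian S)) (a : Lp) :
    dirDerivRight a (pullback D.f S) = 0 := by
  have hconormal : ω.shifted (D.f.lin a) ∘ₗ D.f.lin = 0 :=
    LinearMap.ext fun c => D.shifted_f_f a c
  have h := hf.pullback_apply (ω.shifted (D.f.lin a))
  rw [ω.hamiltonian_shifted, hconormal, map_zero] at h
  exact (CSym.rightDeriv_map _ _ _).trans h

lemma pullback_eq_zero [CharZero k] {S : Fun G} (hS₀ : CSym.coeff 0 S = 0) {Qp : VectorField Lp}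
    (hf : IsStrictMap D.f Qp (ω.hamiltonian S)) : pullback D.f S = 0 := by
  refine CSym.eq_zero_of_euler_eq_zero ?_ (by rw [pullback, CSym.coeff_map, hS₀, map_zero])
  have hdual (z : Module.Dual k Lp) : ∑ i, Module.Dual.eval k Lp (Module.finBasis k Lp i) z •
      (Module.finBasis k Lp).coord i = z := (Module.finBasis k Lp).ext fun j => by simp
  rw [CSym.euler_eq_sum (A := (Lp.shift 1).dual) hdual]
  refine Finset.sum_eq_zero fun i _ => ?_
  exact (congrArg (· * _) (D.dirDerivRight_pullback_eq_zero hf _)).trans (zero_mul _)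

lemma component_zero_toPolyVec [CharZero k] {S : Fun G} (hS₀ : CSym.coeff 0 S = 0)
    {Qp : VectorField Lp} (hf : IsStrictMap D.f Qp (ω.hamiltonian S)) :
    PolyVec.component 0 (D.toPolyVec S) = 0 := by
  rw [PolyVec.component_zero, restrict_toPolyVec, D.pullback_eq_zero hS₀ hf, map_zero]

lemma component_one_toPolyVec {S : Fun G} {Qp : VectorField Lp}
    (hf : IsStrictMap D.f Qp (ω.hamiltonian S)) :
    PolyVec.component 1 (D.toPolyVec S) = PolyVec.ofVectorField n Qp := by
  rw [PolyVec.component_one, PolyVec.ofVectorField]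
  refine Finset.sum_congr rfl fun i _ => ?_
  obtain ⟨b, hb⟩ := D.pairing_surjective ((Module.finBasis k Lp).coord i)
  have h : pullback D.f (dirDerivRight (D.g.lin b) S) = Qp (D.pairing b) := by
    rw [← ω.hamiltonian_shifted]
    exact hf.pullback_apply (ω.shifted (D.g.lin b))
  rw [← hb, rightDeriv_fibreDual_toPolyVec, restrict_toPolyVec, h]

end LagrangianSplitting

end

theorem mainTheorem4 {k : Type u} [Field k] [CharZero k] {n : ℤ}
    {G : GrSpace.{u, v} k} {Lp : GrSpace.{u, w} k} {Lm : GrSpace.{u, x} k}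
    (ω : ShiftedSymplectic G n)
    -- the `L_∞` structure on `𝔤`, given by the action functional `S`
    (Q : VectorField G) (hQ : Q.IsLInfinity)
    (S : Fun G) (hS : CSym.IsHomog (n + 1) S)
    (hS₀ : CSym.coeff 0 S = 0) (hS₁ : CSym.coeff 1 S = 0)
    (hQS : Q = ω.hamiltonian S)
    -- the regular embedded Lagrangian and the complement
    (Qp : VectorField Lp) (hQp : Qp.IsLInfinity)
    (D : LagrangianSplitting ω Lp Lm) (hf : IsStrictMap D.f Qp Q) :
    -- the pieces of `S` are polyvector fields of degree `j` on `L₊`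
    (∀ j, PolyVec.IsPolyDegree j (PolyVec.component j (D.toPolyVec S)) ∧
      CSym.IsHomog (n + 1) (PolyVec.component j (D.toPolyVec S))) ∧
    PolyVec.component 0 (D.toPolyVec S) = 0 ∧
    PolyVec.component 1 (D.toPolyVec S) = PolyVec.ofVectorField n Qp ∧
    D.toPolyVec S = PolyVec.ofVectorField n Qp +
      PolyVec.tower (fun j => PolyVec.component j (D.toPolyVec S)) ∧
    PolyVec.IsHomotopyPoisson Qp (fun j => PolyVec.component j (D.toPolyVec S)) ∧
    -- the classical master equation is the homotopy Poisson equation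
    (∀ T : Fun G, CSym.IsHomog (n + 1) T →
      (ω.bracket T T = 0 ↔ PolyVec.schouten (D.toPolyVec T) (D.toPolyVec T) = 0)) := by
  subst hQS
  have hP : CSym.IsHomog (n + 1) (D.toPolyVec S) := hS.map _
  have h₀ := D.component_zero_toPolyVec hS₀ hf
  have h₁ := D.component_one_toPolyVec hf
  have hsum := PolyVec.eq_components_add_tower (D.toPolyVec S)
  rw [h₀, h₁, zero_add] at hsum
  have hpoly (j : ℕ) := PolyVec.isPolyDegree_component j (D.toPolyVec S)
  have hdeg (j : ℕ) := PolyVec.isHomog_component hP j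
  have hmaster := D.schouten_toPolyVec_self_eq_zero_iff
  refine ⟨fun j => ⟨hpoly j, hdeg j⟩, h₀, h₁, hsum,
    ⟨fun j _ => hpoly j, fun j _ => hdeg j, ?_⟩, fun T _ => (hmaster T).symm⟩
  rw [← hsum, hmaster]
  exact ω.bracket_self_eq_zero hS hS₁ hQ
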